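/- Let $N,m\ge 1$ be integers, let $M=\mathbb{T}^N=\mathbb{R}^N/\mathbb{Z}^N$ be the flat torus, with all tangent and cotangent spaces identified with $\mathbb{R}^N$ (Euclidean norm $|\cdot|$), and let $\|\cdot\|$ be the maximum norm on $\mathbb{R}^m$. For $1\le i\le m$ let $H_i:M\times\mathbb{R}^N\times\mathbb{R}^m\to\mathbb{R}$, $(x,p,\mathbf{u})\mapsto H_i(x,p,\mathbf{u})$, satisfy: (H1) $H_i$ is of class $C^2$ in $(x,p,\mathbf{u})$; (H2) $p\mapsto H_i(x,p,\mathbf{u})$ is strictly convex for every $(x,\mathbf{u})$; (H3) $H_i(x,p,\mathbf{u})/|p|\to\infty$ as $|p|\to\infty$, for every $(x,\mathbf{u})$; (H4) there is $\Theta_i>0$ such that $|H_i(x,p,\mathbf{u})-H_i(x,p,\mathbf{v})|\le\Theta_i\|\mathbf{u}-\mathbf{v}\|$ for all $x,p,\mathbf{u},\mathbf{v}$. Let $L_i(x,v,\mathbf{u})=\sup_{p\in\mathbb{R}^N}\{\langle p,v\rangle-H_i(x,p,\mathbf{u})\}$ be the convex dual of $H_i$, and let $\varphi\in C(M,\mathbb{R}^m)$.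 Consider the Cauchy problem $$\partial_t u_i+H_i(x,\partial_x u_i,\mathbf{u})=0\ \text{ on } M\times[0,\infty),\qquad \mathbf{u}(\cdot,0)=\varphi,\qquad 1\le i\le m. \tag{1}$$ A continuous function $\mathbf{u}:M\times[0,\infty)\to\mathbb{R}^m$ is a viscosity subsolution (resp. supersolution) of (1) if for each $i$ one has $u_i(\cdot,0)\le\varphi_i$ (resp. $\ge$) on $M$ and, whenever $\psi$ is a real-valued $C^1$ function near a point $(x,t)$ with $t>0$ such that $u_i-\psi$ has a local maximum (resp. minimum) at $(x,t)$, $$\partial_t\psi(x,t)+H_i(x,\partial_x\psi(x,t),\mathbf{u}(x,t))\le 0\quad(\text{resp. }\ge 0).$$ It is a viscosity solution if it is both. Then (1) has a unique viscosity solution $\mathbf{u}\in C(M\times[0,\infty),\mathbb{R}^m)$. Moreover, a function $\mathbf{u}\in C(M\times[0,\infty),\mathbb{R}^m)$ is a viscosity solution of (1) if and only if, for all $1\le i\le m$ and all $(x,t)\in M\times[0,\infty)$, $$u_i(x,t)=\inf_{\gamma}\Big\{\varphi_i(\gamma(0))+\int_0^t L_i(\gamma(s),\dot\gamma(s),\mathbf{u}(\gamma(s),s))\,ds\Big\},$$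 where the infimum is over all absolutely continuous curves $\gamma:[0,t]\to M$ with $\gamma(t)=x$ (the integral being possibly $+\infty$). In particular, the unique viscosity solution is given by this implicit formula. -/

import Mathlib

open scoped NNReal

noncomputable section

namespace WeaklyCoupledHJ

/-- The Euclidean space `ℝ^N`; every tangent and cotangent space of the flat torus is identified
with it. -/
abbrev E (N : ℕ) : Type := EuclideanSpace ℝ (Fin N)

/-- The flat torus `M = 𝕋^N = ℝ^N / ℤ^N`. -/
abbrev Torus (N : ℕ) : Type := UnitAddTorus (Fin N)

/-- The quotient map `ℝ^N → 𝕋^N`. -/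
def proj {N : ℕ} (x : E N) : Torus N := fun j => ((x j : ℝ) : UnitAddCircle)

/-- The standing conditions on a single Hamiltonian `H(x, p, u)` on `T*M × ℝ^m`. The space `ℝ^m` is
`Fin m → ℝ`, which carries the maximum norm. Regularity on the torus is regularity of the lift
to `ℝ^N`. -/
structure IsAdmissible {N m : ℕ} (H : Torus N → E N → (Fin m → ℝ) → ℝ) : Prop where
  /-- `H` is of class `C²` in `(x, p, u)`. -/
  contDiff : ContDiff ℝ 2 (fun q : E N × E N × (Fin m → ℝ) => H (proj q.1) q.2.1 q.2.2)
  /-- `H` is strictly convex in `p`. -/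
  strictConvex : ∀ x u, StrictConvexOn ℝ Set.univ (fun p => H x p u)
  /-- `H` is superlinear in `p`. -/
  superlinear : ∀ x u,
    Filter.Tendsto (fun p => H x p u / ‖p‖) (Bornology.cobounded (E N)) Filter.atTop
  /-- `H` is Lipschitz in `u`, uniformly in `(x, p)`. -/
  lipschitz : ∃ Θ : ℝ, 0 < Θ ∧ ∀ x p u v, |H x p u - H x p v| ≤ Θ * ‖u - v‖

/-- The convex dual `L(x, v, u) = sup_p (⟨p, v⟩ - H(x, p, u))`; the supremum is that of a set which
is bounded above whenever `H` is continuous and superlinear in `p`. -/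
def lagrangian {N m : ℕ} (H : Torus N → E N → (Fin m → ℝ) → ℝ)
    (x : Torus N) (v : E N) (u : Fin m → ℝ) : ℝ :=
  ⨆ p : E N, (inner ℝ p v - H x p u)

/-- Viscosity subsolutions of `∂ₜ uᵢ + Hᵢ(x, ∂ₓ uᵢ, u) = 0` on `𝕋^N × [0, ∞)` with initial datum `φ`.
Since `proj` is a local diffeomorphism, a `C¹` test function near a point `(proj x, t)` of
`𝕋^N × (0, ∞)` is the same as a `C¹` function `ψ` near `(x, t)`. -/
def IsViscositySubsolution {N m : ℕ} (H : Fin m → Torus N → E N → (Fin m → ℝ) → ℝ)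
    (φ : C(Torus N, Fin m → ℝ)) (u : C(Torus N × ℝ≥0, Fin m → ℝ)) : Prop :=
  ∀ i : Fin m,
    (∀ x, u (x, 0) i ≤ φ x i) ∧
    ∀ (x : E N) (t : ℝ), 0 < t → ∀ ψ : E N × ℝ → ℝ, ContDiffAt ℝ 1 ψ (x, t) →
      IsLocalMax (fun q : E N × ℝ => u (proj q.1, q.2.toNNReal) i - ψ q) (x, t) →
      deriv (fun s => ψ (x, s)) t
        + H i (proj x) (gradient (fun y => ψ (y, t)) x) (u (proj x, t.toNNReal)) ≤ 0

/-- Viscosity supersolutions of the same Cauchy problem. -/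
def IsViscositySupersolution {N m : ℕ} (H : Fin m → Torus N → E N → (Fin m → ℝ) → ℝ)
    (φ : C(Torus N, Fin m → ℝ)) (u : C(Torus N × ℝ≥0, Fin m → ℝ)) : Prop :=
  ∀ i : Fin m,
    (∀ x, φ x i ≤ u (x, 0) i) ∧
    ∀ (x : E N) (t : ℝ), 0 < t → ∀ ψ : E N × ℝ → ℝ, ContDiffAt ℝ 1 ψ (x, t) →
      IsLocalMin (fun q : E N × ℝ => u (proj q.1, q.2.toNNReal) i - ψ q) (x, t) →
      0 ≤ deriv (fun s => ψ (x, s)) t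
        + H i (proj x) (gradient (fun y => ψ (y, t)) x) (u (proj x, t.toNNReal))

/-- Viscosity solutions: both sub- and supersolutions. -/
def IsViscositySolution {N m : ℕ} (H : Fin m → Torus N → E N → (Fin m → ℝ) → ℝ)
    (φ : C(Torus N, Fin m → ℝ)) (u : C(Torus N × ℝ≥0, Fin m → ℝ)) : Prop :=
  IsViscositySubsolution H φ u ∧ IsViscositySupersolution H φ u

/-- The integrand `s ↦ L(γ(s), γ'(s), u(γ(s), s))` along a curve on the torus given by its
lift `γ` to `ℝ^N`. -/
def lagrangianAlong {N m : ℕ} (H : Torus N → E N → (Fin m → ℝ) → ℝ)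
    (u : C(Torus N × ℝ≥0, Fin m → ℝ)) (γ : ℝ → E N) (s : ℝ) : ℝ :=
  lagrangian H (proj (γ s)) (deriv γ s) (u (proj (γ s), s.toNNReal))

/-- The values `φᵢ(γ(0)) + ∫₀ᵗ Lᵢ(γ, γ', u(γ(s), s)) ds` over the absolutely continuous curves `γ`
on the torus with `γ(t) = x`. The absolutely continuous curves on `𝕋^N` are the projections of those
in `ℝ^N`, with the same velocity. The integrand is bounded below along each of them, so its integral
is finite or `+∞`; the curves of infinite action, for which the Bochner integral would take the
value `0`, do not contribute to the infimum and are left out. -/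
def actionValues {N m : ℕ} (H : Fin m → Torus N → E N → (Fin m → ℝ) → ℝ)
    (φ : C(Torus N, Fin m → ℝ)) (u : C(Torus N × ℝ≥0, Fin m → ℝ))
    (i : Fin m) (x : Torus N) (t : ℝ≥0) : Set ℝ :=
  {a | ∃ γ : ℝ → E N, AbsolutelyContinuousOnInterval γ 0 t ∧ proj (γ t) = x ∧
    IntervalIntegrable (lagrangianAlong (H i) u γ) MeasureTheory.volume 0 t ∧
    a = φ (proj (γ 0)) i + ∫ s in (0 : ℝ)..t, lagrangianAlong (H i) u γ s}

/-- Variational solutions, i.e. `u` satisfies the implicit Lax-Oleinik formula. As a greatest lower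
bound in `ℝ`, the infimum is over a nonempty set that is bounded below. -/
def IsVariationalSolution {N m : ℕ} (H : Fin m → Torus N → E N → (Fin m → ℝ) → ℝ)
    (φ : C(Torus N, Fin m → ℝ)) (u : C(Torus N × ℝ≥0, Fin m → ℝ)) : Prop :=
  ∀ (i : Fin m) (x : Torus N) (t : ℝ≥0), IsGLB (actionValues H φ u i x t) (u (x, t) i)

end WeaklyCoupledHJ

end

noncomputable section

namespace WeaklyCoupledHJ

/-! ### The torus and its universal cover -/

/-! Freeze the coupling. For a fixed continuous `u`, the `i`-th equation is a scalar Hamilton-Jacobi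
equation in which `u(x, t)` is a known function, and its Lax-Oleinik function `value` depends on `u`
in a controlled way: replacing `u` by `u'` changes it at time `t` by at most `Θ` times the integral
over `[0, t]` of any continuous bound for `‖u' - u‖` (`value_le_of_coupling`). A variational
solution is a fixed point of `valueMap`. In the sup norm weighted by `e^{-2Θt}` this map contracts
by `1/2`, so Banach's theorem gives `exists_isVariationalSolution`.

A fixed point is a viscosity solution by dynamic programming. For the subsolution test, follow a
straight segment whose velocity attains the supremum in the duality between `H` and `L`
(`subsolution_test`). For the supersolution test, follow a nearly optimal curve; superlinearity of
`L` keeps it near the test point for a short time (`supersolution_test`). Minimizers are never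
needed.

That viscosity solutions are variational is deduced from uniqueness: any viscosity solution equals
the one just constructed. Uniqueness rests on doubling of variables for the frozen scalar equations
(`comparison`). No monotonicity in `u` is required, since the difference of the couplings is only an
error term. If it is at most `d e^{2Θt}`, the corrector `κ + (d/2) e^{2Θt}` absorbs it, and taking
`d` to be the weighted distance of the two solutions yields `d ≤ κ + d/2`, where `κ` bounds the
difference of the data.

The doubling argument needs the momenta `c(x - y)` to stay bounded, because `H` is merely continuous
in `x` locally uniformly in `p`. This holds once one of the two functions is Lipschitz in space. A
general datum is therefore approximated by a Lipschitz one, whose variational solution is Lipschitz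
(`IsVariationalSolution.exists_lipschitz_space`), and two solutions with the same datum are both
close to that solution. -/

lemma proj_add {N : ℕ} (x y : E N) : proj (x + y) = proj x + proj y := by
  funext j; simp [proj]

lemma proj_sub {N : ℕ} (x y : E N) : proj (x - y) = proj x - proj y := by
  funext j; simp [proj]

lemma isOpenQuotientMap_proj (N : ℕ) : IsOpenQuotientMap (proj : E N → Torus N) := by
  have h1 : IsOpenQuotientMap (Pi.map fun _ : Fin N => ((↑) : ℝ → UnitAddCircle)) :=
    IsOpenQuotientMap.piMap fun _ => QuotientAddGroup.isOpenQuotientMap_mk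
  exact h1.comp (EuclideanSpace.equiv (Fin N) ℝ).toHomeomorph.isOpenQuotientMap

lemma continuous_proj (N : ℕ) : Continuous (proj : E N → Torus N) :=
  (isOpenQuotientMap_proj N).continuous

lemma proj_surjective (N : ℕ) : Function.Surjective (proj : E N → Torus N) :=
  (isOpenQuotientMap_proj N).surjective

/-- A bounded set of representatives lets maxima of periodic functions on `ℝ^N` be sought in a
compact ball. -/
lemma exists_bounded_lift (N : ℕ) : ∃ R : ℝ, ∀ x : Torus N, ∃ y : E N, proj y = x ∧ ‖y‖ ≤ R := by
  have hc : IsCompact (WithLp.toLp 2 '' (Set.univ.pi fun _ : Fin N => Set.Icc (0 : ℝ) 1)) :=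
    (isCompact_univ_pi fun _ => isCompact_Icc).image (PiLp.continuous_toLp 2 _)
  obtain ⟨R, hR⟩ := hc.isBounded.exists_norm_le
  refine ⟨R, fun x => ?_⟩
  have h : ∀ j, ∃ r ∈ Set.Ico (0 : ℝ) (0 + 1), ((r : ℝ) : UnitAddCircle) = x j := fun j => by
    have := AddCircle.coe_image_Ico_eq (1 : ℝ) 0
    have hx : x j ∈ (QuotientAddGroup.mk '' Set.Ico (0 : ℝ) (0 + 1) : Set UnitAddCircle) := by
      rw [this]; trivial
    exact hx
  choose r hr hrx using h
  refine ⟨WithLp.toLp 2 r, funext fun j => hrx j, hR _ ⟨r, fun j _ => ?_, rfl⟩⟩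
  have := hr j
  exact ⟨this.1, by linarith [this.2]⟩

lemma dist_proj_le {N : ℕ} (x y : E N) : dist (proj x) (proj y) ≤ ‖x - y‖ := by
  refine (dist_pi_le_iff (norm_nonneg _)).2 fun j => ?_
  have h1 : dist (proj x j) (proj y j) ≤ ‖x j - y j‖ := by
    rw [dist_eq_norm]
    exact QuotientAddGroup.norm_mk_le_norm (S := AddSubgroup.zmultiples (1 : ℝ)) (m := x j - y j)
  exact h1.trans (PiLp.norm_apply_le (x - y) j)

/-- Lipschitz functions are uniformly dense in the continuous functions on a compact space. -/
lemma exists_lipschitz_near {X : Type*} [PseudoMetricSpace X] [CompactSpace X]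
    (f : C(X, ℝ)) {ε : ℝ} (hε : 0 < ε) :
    ∃ (g : X → ℝ) (K : ℝ), 0 ≤ K ∧ (∀ x, |g x - f x| ≤ ε) ∧
      ∀ x y, |g x - g y| ≤ K * dist x y := by
  rcases isEmpty_or_nonempty X with hX | hX
  · exact ⟨fun _ => 0, 0, le_rfl, fun x => isEmptyElim x, fun x => isEmptyElim x⟩
  obtain ⟨δ, hδ, hf⟩ := Metric.uniformContinuous_iff.1
    (CompactSpace.uniformContinuous_of_continuous f.continuous) ε hε
  have hB : ∀ x, |f x| ≤ ‖f‖ := fun x => f.norm_coe_le_norm x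
  -- With this slope the penalty `K * dist x y` exceeds the oscillation of `f` as soon as `dist x y
  -- ≥ δ`, so the infimal convolution below differs from `f` by at most `ε`.
  set K : ℝ := 2 * ‖f‖ / δ with hK
  have hK0 : 0 ≤ K := by positivity
  have hbdd : ∀ x, BddBelow (Set.range fun y => f y + K * dist x y) := fun x =>
    ⟨-‖f‖, by
      rintro _ ⟨y, rfl⟩
      have := (abs_le.1 (hB y)).1
      have : 0 ≤ K * dist x y := by positivity
      simp only; linarith⟩
  refine ⟨fun x => ⨅ y, (f y + K * dist x y), K, hK0, fun x => ?_, fun x y => ?_⟩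
  · rw [abs_le]
    constructor
    · have : f x - ε ≤ ⨅ y, (f y + K * dist x y) := by
        refine le_ciInf fun y => ?_
        rcases lt_or_ge (dist x y) δ with h | h
        · have h1 := hf h
          rw [Real.dist_eq, abs_lt] at h1
          have : 0 ≤ K * dist x y := by positivity
          linarith [h1.2]
        · have h1 : 2 * ‖f‖ ≤ K * dist x y := by
            calc 2 * ‖f‖ = K * δ := by rw [hK]; field_simp
              _ ≤ _ := by gcongr
          have h2 := (abs_le.1 (hB y)).1
          have h3 := (abs_le.1 (hB x)).2
          linarith
      linarith
    · have := ciInf_le (hbdd x) x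
      simp only [dist_self, mul_zero, add_zero] at this
      linarith
  · have key : ∀ x y, (⨅ z, (f z + K * dist x z)) ≤ (⨅ z, (f z + K * dist y z)) + K * dist x y := by
      intro x y
      rw [← sub_le_iff_le_add]
      refine le_ciInf fun z => ?_
      have h1 := ciInf_le (hbdd x) z
      have h2 : K * dist x z ≤ K * (dist x y + dist y z) := by gcongr; exact dist_triangle _ _ _
      linarith
    rw [abs_le]
    have h1 := key x y
    have h2 := key y x
    rw [dist_comm y x] at h2
    constructor <;> linarith

lemma exists_lipschitz_datum {N m : ℕ} (φ : C(Torus N, Fin m → ℝ)) {ε : ℝ} (hε : 0 < ε) :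
    ∃ (φ' : C(Torus N, Fin m → ℝ)) (K : ℝ), 0 ≤ K ∧ (∀ x i, |φ' x i - φ x i| ≤ ε) ∧
      ∀ (x y : E N) i, φ' (proj x) i - φ' (proj y) i ≤ K * ‖x - y‖ := by
  choose g K hK hg hL using fun i : Fin m =>
    exists_lipschitz_near (⟨fun x => φ x i, by fun_prop⟩ : C(Torus N, ℝ)) hε
  have hgc : ∀ i, Continuous (g i) := fun i => by
    refine (LipschitzWith.of_dist_le_mul (K := ⟨K i, hK i⟩) fun x y => ?_).continuous
    rw [Real.dist_eq]; exact hL i x y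
  refine ⟨⟨fun x i => g i x, by fun_prop⟩, ∑ i, K i, Finset.sum_nonneg fun i _ => hK i,
    fun x i => hg i x, fun x y i => ?_⟩
  calc g i (proj x) - g i (proj y) ≤ K i * dist (proj x) (proj y) :=
        (le_abs_self _).trans (hL i _ _)
    _ ≤ (∑ i, K i) * ‖x - y‖ := by
        gcongr
        · exact Finset.sum_nonneg fun i _ => hK i
        · exact Finset.single_le_sum (fun i _ => hK i) (Finset.mem_univ i)
        · exact dist_proj_le x y

/-- Every continuous datum has, up to an additive error, a linear modulus of continuity. -/
lemma exists_modulus_datum {N m : ℕ} (φ : C(Torus N, Fin m → ℝ)) {κ : ℝ} (hκ : 0 < κ) :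
    ∃ K : ℝ, 0 ≤ K ∧ ∀ (x y : E N) i, φ (proj x) i - φ (proj y) i ≤ κ + K * ‖x - y‖ := by
  obtain ⟨φ', K, hK, h1, h2⟩ := exists_lipschitz_datum φ (half_pos hκ)
  refine ⟨K, hK, fun x y i => ?_⟩
  have ha := abs_le.1 (h1 (proj x) i)
  have hb := abs_le.1 (h1 (proj y) i)
  linarith [h2 x y i]

/-! ### The Hamiltonian and its convex dual -/

section Lagrangian

variable {N m : ℕ} {H : Torus N → E N → (Fin m → ℝ) → ℝ} {Θ : ℝ}

/-- `H` is `Θ`-Lipschitz in `u`, uniformly in `(x, p)`. -/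
def LipschitzInU (H : Torus N → E N → (Fin m → ℝ) → ℝ) (Θ : ℝ) : Prop :=
  ∀ x p u v, |H x p u - H x p v| ≤ Θ * ‖u - v‖

lemma IsAdmissible.continuous (hH : IsAdmissible H) :
    Continuous fun q : Torus N × E N × (Fin m → ℝ) => H q.1 q.2.1 q.2.2 :=
  ((isOpenQuotientMap_proj N).prodMap IsOpenQuotientMap.id).continuous_comp_iff.1
    hH.contDiff.continuous

lemma LipschitzInU.abs_sub_zero (hΘ : LipschitzInU H Θ) (x : Torus N) (p : E N)
    (u : Fin m → ℝ) : |H x p u - H x p 0| ≤ Θ * ‖u‖ := by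
  simpa using hΘ x p u 0

lemma IsAdmissible.exists_bound (hH : IsAdmissible H) (hΘ : LipschitzInU H Θ) (R : ℝ) :
    ∃ B, 0 ≤ B ∧ ∀ x p u, ‖p‖ ≤ R → |H x p u| ≤ B + Θ * ‖u‖ := by
  have hc : Continuous fun q : Torus N × E N => H q.1 q.2 0 :=
    hH.continuous.comp (f := fun q : Torus N × E N => (q.1, q.2, (0 : Fin m → ℝ))) (by fun_prop)
  obtain ⟨B, hB⟩ := (isCompact_univ.prod
    (isCompact_closedBall (0 : E N) R)).exists_bound_of_continuousOn hc.continuousOn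
  refine ⟨max B 0, le_max_right _ _, fun x p u hp => ?_⟩
  have h1 : |H x p 0| ≤ B := hB (x, p) ⟨trivial, by simpa using hp⟩
  have h2 := abs_le.1 (hΘ.abs_sub_zero x p u)
  have h3 := abs_le.1 h1
  have := le_max_left B 0
  rw [abs_le]
  constructor <;> linarith

/-- Superlinearity is only assumed pointwise in `x`; convexity makes it locally uniform. A strict
inequality on one large sphere in `p` persists for nearby `x` by compactness of the sphere, and
convexity on the segment from `0` to `p` carries it to all `p` outside. -/
lemma IsAdmissible.superlinear_near (hH : IsAdmissible H) (A : ℝ) (x₀ : Torus N) :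
    ∃ R : ℝ, 0 < R ∧ ∀ᶠ x in nhds x₀, ∀ p, R ≤ ‖p‖ → A * ‖p‖ + H x 0 0 ≤ H x p 0 := by
  -- The surplus `1 + |H x₀ 0 0|` in the slope, multiplied by a radius `R ≥ 1`, beats `H x₀ 0 0`
  -- strictly.
  have h1 := (hH.superlinear x₀ 0).eventually_ge_atTop (A + 1 + |H x₀ 0 0|)
  obtain ⟨r, -, hr⟩ := (Metric.hasBasis_cobounded_compl_closedBall (0 : E N)).eventually_iff.1 h1
  set R := max r 0 + 1 with hR
  have hR0 : 1 ≤ R := by have := le_max_right r 0; linarith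
  have hRr : r < R := by have := le_max_left r 0; linarith
  have hsph : ∀ p ∈ Metric.sphere (0 : E N) R, A * R + H x₀ 0 0 < H x₀ p 0 := by
    intro p hp
    have hp' : ‖p‖ = R := by simpa using hp
    have h2 := hr (x := p) (by simp [hp', hRr])
    rw [hp', le_div_iff₀ (by linarith)] at h2
    have h3 : |H x₀ 0 0| ≤ |H x₀ 0 0| * R := le_mul_of_one_le_right (abs_nonneg _) hR0
    have := le_abs_self (H x₀ 0 0)
    nlinarith
  have hc : Continuous fun z : Torus N × E N => H z.1 z.2 0 - H z.1 0 0 :=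
    (hH.continuous.comp (f := fun q : Torus N × E N => (q.1, q.2, (0 : Fin m → ℝ)))
      (by fun_prop)).sub
    (hH.continuous.comp (f := fun q : Torus N × E N => (q.1, (0 : E N), (0 : Fin m → ℝ)))
      (by fun_prop))
  have h4 : ∀ᶠ x in nhds x₀, ∀ p ∈ Metric.sphere (0 : E N) R, A * R < H x p 0 - H x 0 0 := by
    refine (isCompact_sphere (0 : E N) R).eventually_forall_of_forall_eventually
      (P := fun x p => A * R < H x p 0 - H x 0 0) fun p hp => ?_
    exact hc.continuousAt.eventually (lt_mem_nhds (by simp only; linarith [hsph p hp]))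
  refine ⟨R, by linarith, h4.mono fun x hx p hp => ?_⟩
  have hp0 : 0 < ‖p‖ := by linarith
  set c := R / ‖p‖ with hc
  have hc0 : 0 < c := by positivity
  have hc1 : c ≤ 1 := (div_le_one hp0).2 hp
  have h5 := hx (c • p) (by
    rw [mem_sphere_iff_norm, sub_zero, norm_smul, Real.norm_of_nonneg hc0.le, hc]
    field_simp)
  have h6 := (hH.strictConvex x 0).convexOn.2 (Set.mem_univ p) (Set.mem_univ 0) hc0.le
    (sub_nonneg.2 hc1) (by ring)
  simp only [smul_zero, add_zero, smul_eq_mul] at h6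
  have h7 : A * R = c * (A * ‖p‖) := by rw [hc]; field_simp
  have h8 : c * (A * ‖p‖ + H x 0 0) ≤ c * H x p 0 := by nlinarith
  exact le_of_mul_le_mul_left h8 hc0

/-- Compactness of the torus makes the local radii of `superlinear_near` uniform, and the Lipschitz
bound in `u` transfers the estimate from `u = 0` to all `u`. -/
lemma IsAdmissible.exists_superlinear (hH : IsAdmissible H) (hΘ : LipschitzInU H Θ) {A : ℝ}
    (hA : 0 ≤ A) : ∃ C, ∀ x p u, A * ‖p‖ - C - Θ * ‖u‖ ≤ H x p u := by
  have hR : ∃ R : ℝ, 0 < R ∧ ∀ x ∈ (Set.univ : Set (Torus N)), ∀ p, R ≤ ‖p‖ →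
      A * ‖p‖ + H x 0 0 ≤ H x p 0 := by
    refine isCompact_univ.induction_on
      (p := fun s => ∃ R : ℝ, 0 < R ∧ ∀ x ∈ s, ∀ p, R ≤ ‖p‖ → A * ‖p‖ + H x 0 0 ≤ H x p 0)
      ⟨1, one_pos, by simp⟩ ?_ ?_ ?_
    · rintro s t hst ⟨R, hR, h⟩
      exact ⟨R, hR, fun x hx => h x (hst hx)⟩
    · rintro s t ⟨R, hR, h⟩ ⟨R', -, h'⟩
      refine ⟨max R R', lt_max_of_lt_left hR, fun x hx p hp => ?_⟩
      rcases hx with hx | hx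
      · exact h x hx p ((le_max_left _ _).trans hp)
      · exact h' x hx p ((le_max_right _ _).trans hp)
    · intro x _
      obtain ⟨R, hR, h⟩ := hH.superlinear_near A x
      exact ⟨_, nhdsWithin_le_nhds h, R, hR, fun y hy => hy⟩
  obtain ⟨R, hR, h⟩ := hR
  obtain ⟨B, hB0, hB⟩ := hH.exists_bound hΘ R
  refine ⟨A * R + B, fun x p u => ?_⟩
  have h1 := abs_le.1 (hΘ.abs_sub_zero x p u)
  rcases le_total ‖p‖ R with hp | hp
  · have h2 := abs_le.1 (hB x p u hp)
    have : A * ‖p‖ ≤ A * R := by gcongr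
    linarith
  · have h2 := abs_le.1 (hB x 0 0 (by simpa using hR.le))
    have h3 := h x trivial p hp
    have : 0 ≤ A * R := by positivity
    simp only [norm_zero, mul_zero, add_zero] at h2
    linarith

lemma inner_le_of_norm_le {p v : E N} {A : ℝ} (hv : ‖v‖ ≤ A) : inner ℝ p v ≤ A * ‖p‖ := by
  calc inner ℝ p v ≤ ‖p‖ * ‖v‖ := real_inner_le_norm p v
    _ ≤ ‖p‖ * A := by gcongr
    _ = A * ‖p‖ := mul_comm _ _

lemma IsAdmissible.bddAbove (hH : IsAdmissible H) (x : Torus N) (v : E N) (u : Fin m → ℝ) :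
    BddAbove (Set.range fun p : E N => inner ℝ p v - H x p u) := by
  obtain ⟨Θ, -, hΘ⟩ := hH.lipschitz
  obtain ⟨C, hC⟩ := hH.exists_superlinear hΘ (norm_nonneg v)
  refine ⟨C + Θ * ‖u‖, ?_⟩
  rintro _ ⟨p, rfl⟩
  have h1 := hC x p u
  have h2 := inner_le_of_norm_le (p := p) (le_refl ‖v‖)
  simp only; linarith

lemma IsAdmissible.inner_sub_le (hH : IsAdmissible H) (x : Torus N) (v p : E N)
    (u : Fin m → ℝ) : inner ℝ p v - H x p u ≤ lagrangian H x v u :=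
  le_ciSup (hH.bddAbove x v u) p

lemma IsAdmissible.lagrangian_sub_le (hH : IsAdmissible H) (hΘ : LipschitzInU H Θ) (x : Torus N)
    (v : E N) (u u' : Fin m → ℝ) :
    |lagrangian H x v u - lagrangian H x v u'| ≤ Θ * ‖u - u'‖ := by
  have key : ∀ u u', lagrangian H x v u ≤ lagrangian H x v u' + Θ * ‖u - u'‖ := by
    intro u u'
    refine ciSup_le fun p => ?_
    have h1 := hH.inner_sub_le x v p u'
    have h2 := abs_le.1 (hΘ x p u u')
    linarith
  have h1 := key u u'
  have h2 := key u' u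
  rw [norm_sub_rev] at h2
  rw [abs_le]
  constructor <;> linarith

/-- Testing the supremum with the momentum of length `A` in the direction of `v` gives slope `A`, at
the price of the bound of `H` on the ball of radius `A`. -/
lemma IsAdmissible.exists_lagrangian_ge (hH : IsAdmissible H) (hΘ : LipschitzInU H Θ) {A : ℝ}
    (hA : 0 ≤ A) : ∃ C, 0 ≤ C ∧ ∀ x v u, A * ‖v‖ - C - Θ * ‖u‖ ≤ lagrangian H x v u := by
  obtain ⟨B, hB0, hB⟩ := hH.exists_bound hΘ A
  refine ⟨B, hB0, fun x v u => ?_⟩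
  have hp : ‖(A / ‖v‖) • v‖ ≤ A ∧ inner ℝ ((A / ‖v‖) • v) v = A * ‖v‖ := by
    rcases eq_or_ne v 0 with rfl | hv
    · simpa using hA
    · have hv' : ‖v‖ ≠ 0 := norm_ne_zero_iff.2 hv
      constructor
      · rw [norm_smul, norm_div, norm_norm, Real.norm_of_nonneg hA]
        apply le_of_eq; field_simp
      · rw [real_inner_smul_left, real_inner_self_eq_norm_sq]; field_simp
  have h1 := hH.inner_sub_le x v ((A / ‖v‖) • v) u
  have h2 := abs_le.1 (hB x _ u hp.1)
  rw [hp.2] at h1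
  linarith

/-- Near a given point the supremum over `p` may be restricted to one fixed compact ball, and a
supremum of a jointly continuous function over a compact set is continuous. -/
lemma IsAdmissible.continuous_lagrangian (hH : IsAdmissible H) :
    Continuous fun q : Torus N × E N × (Fin m → ℝ) => lagrangian H q.1 q.2.1 q.2.2 := by
  obtain ⟨Θ, hΘ0, hΘ⟩ := hH.lipschitz
  rw [continuous_iff_continuousAt]
  rintro ⟨x₀, v₀, u₀⟩
  obtain ⟨C, hC⟩ := hH.exists_superlinear hΘ (A := ‖v₀‖ + 2) (by positivity)
  obtain ⟨B, hB0, hB⟩ := hH.exists_bound hΘ 0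
  -- The slope `‖v₀‖ + 2` against velocities below `‖v₀‖ + 1` leaves a surplus `‖p‖`; beyond this
  -- `R` the surplus makes `p` worse than `p = 0`.
  set R := |C| + 2 * (Θ * (‖u₀‖ + 1)) + B with hR
  have hR0 : 0 ≤ R := by positivity
  have hf : Continuous (fun q : (Torus N × E N × (Fin m → ℝ)) × E N =>
      inner ℝ q.2 q.1.2.1 - H q.1.1 q.2 q.1.2.2) := by
    refine Continuous.sub (by fun_prop) ?_
    exact hH.continuous.comp
      (f := fun q : (Torus N × E N × (Fin m → ℝ)) × E N => (q.1.1, q.2, q.1.2.2)) (by fun_prop)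
  have hS := (isCompact_closedBall (0 : E N) R).continuous_sSup
    (f := fun (q : Torus N × E N × (Fin m → ℝ)) (p : E N) =>
      inner ℝ p q.2.1 - H q.1 p q.2.2) hf
  refine hS.continuousAt.congr ?_
  have hn : ∀ᶠ q : Torus N × E N × (Fin m → ℝ) in nhds (x₀, v₀, u₀),
      ‖q.2.1‖ < ‖v₀‖ + 1 ∧ ‖q.2.2‖ < ‖u₀‖ + 1 := by
    refine Filter.Eventually.and ?_ ?_
    · exact (by fun_prop : Continuous fun q : Torus N × E N × (Fin m → ℝ) =>
        ‖q.2.1‖).continuousAt.eventually (gt_mem_nhds (by simp))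
    · exact (by fun_prop : Continuous fun q : Torus N × E N × (Fin m → ℝ) =>
        ‖q.2.2‖).continuousAt.eventually (gt_mem_nhds (by simp))
  filter_upwards [hn]
  rintro ⟨x, v, u⟩ ⟨hv, hu⟩
  simp only at hv hu ⊢
  have hbdd : BddAbove ((fun p : E N => inner ℝ p v - H x p u) '' Metric.closedBall 0 R) :=
    (hH.bddAbove x v u).mono (Set.image_subset_range _ _)
  have hne : ((fun p : E N => inner ℝ p v - H x p u) '' Metric.closedBall 0 R).Nonempty :=
    ⟨_, 0, by simpa using hR0, rfl⟩
  refine le_antisymm (csSup_le hne ?_) (ciSup_le fun p => ?_)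
  · rintro _ ⟨p, -, rfl⟩
    exact hH.inner_sub_le x v p u
  · rcases le_or_gt ‖p‖ R with hp | hp
    · exact le_csSup hbdd ⟨p, by simpa using hp, rfl⟩
    · refine le_trans ?_ (le_csSup hbdd ⟨0, by simpa using hR0, rfl⟩)
      have h1 := hC x p u
      have h2 := inner_le_of_norm_le (p := p) hv.le
      have h3 := abs_le.1 (hB x 0 u (by simp))
      have h4 : Θ * ‖u‖ ≤ Θ * (‖u₀‖ + 1) := by gcongr
      have h5 := le_abs_self C
      simp only [inner_zero_left]
      linarith

/-- The supremum in `H = L*` is attained, at the velocity `∂H/∂p`. -/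
lemma IsAdmissible.exists_lagrangian_le (hH : IsAdmissible H) (x : Torus N) (p : E N)
    (u : Fin m → ℝ) : ∃ v : E N, lagrangian H x v u ≤ inner ℝ p v - H x p u := by
  obtain ⟨x, rfl⟩ := proj_surjective N x
  set h : E N → ℝ := fun p => H (proj x) p u with hh
  have hd : DifferentiableAt ℝ h p := by
    have h1 : Differentiable ℝ (fun q : E N × E N × (Fin m → ℝ) => H (proj q.1) q.2.1 q.2.2) :=
      hH.contDiff.differentiable (by norm_num)
    exact (h1.comp (f := fun p : E N => (x, p, u)) (by fun_prop)) p
  refine ⟨gradient h p, ciSup_le fun q => ?_⟩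
  have key : fderiv ℝ h p (q - p) ≤ h q - h p := by
    have hcv : ConvexOn ℝ Set.univ (h ∘ AffineMap.lineMap (k := ℝ) p q) :=
      (hH.strictConvex (proj x) u).convexOn.comp_affineMap (AffineMap.lineMap (k := ℝ) p q)
    have hder : HasDerivAt (h ∘ AffineMap.lineMap (k := ℝ) p q) (fderiv ℝ h p (q - p)) 0 := by
      have h2 : HasFDerivAt h (fderiv ℝ h p) (AffineMap.lineMap (k := ℝ) p q 0) := by
        simpa using hd.hasFDerivAt
      exact h2.comp_hasDerivAt 0 AffineMap.hasDerivAt_lineMap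
    have := hcv.le_slope_of_hasDerivAt trivial trivial (zero_lt_one' ℝ) hder
    simpa [slope_def_field] using this
  rw [← inner_gradient_left, inner_sub_right] at key
  rw [real_inner_comm, real_inner_comm _ p]
  simp only [hh] at key ⊢
  linarith

end Lagrangian

/-! ### Absolutely continuous curves -/

section AbsolutelyContinuous

open AbsolutelyContinuousOnInterval MeasureTheory

variable {X : Type*} [PseudoMetricSpace X]

/-- Reparametrization by a monotone `1`-Lipschitz map preserves absolute continuity. -/
lemma absolutelyContinuousOnInterval_comp_monotone {f : ℝ → X} {g : ℝ → ℝ} {a b c d : ℝ}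
    (hf : AbsolutelyContinuousOnInterval f a b) (hg : Monotone g)
    (hL : ∀ x y, dist (g x) (g y) ≤ dist x y)
    (hmap : ∀ x ∈ Set.uIcc c d, g x ∈ Set.uIcc a b) :
    AbsolutelyContinuousOnInterval (f ∘ g) c d := by
  rw [absolutelyContinuousOnInterval_iff] at hf ⊢
  intro ε hε
  obtain ⟨δ, hδ, h⟩ := hf ε hε
  refine ⟨δ, hδ, ?_⟩
  rintro ⟨n, I⟩ hI hlen
  refine h (n, fun i => (g (I i).1, g (I i).2)) ⟨fun i hi => ?_, fun i hi j hj hij => ?_⟩ ?_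
  · exact ⟨hmap _ (hI.1 i hi).1, hmap _ (hI.1 i hi).2⟩
  · have h1 := hI.2 hi hj hij
    simp only [Function.onFun, Set.uIoc, Set.Ioc_disjoint_Ioc] at h1 ⊢
    rw [← hg.map_min, ← hg.map_min, ← hg.map_max, ← hg.map_max, ← hg.map_min, ← hg.map_max]
    exact hg h1
  · exact (Finset.sum_le_sum fun i _ => hL _ _).trans_lt hlen

/-- Applied below to linear functionals of a curve, to translates, and to `s ↦ ψ (γ s, s)` for a
locally Lipschitz `ψ`; the term `dist s t` accounts for explicit time dependence. -/
lemma absolutelyContinuousOnInterval_of_dist_le {Y : Type*} [PseudoMetricSpace Y] {f : ℝ → X}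
    {k : ℝ → Y} {a b K : ℝ}
    (hf : AbsolutelyContinuousOnInterval f a b)
    (hk : ∀ s ∈ Set.uIcc a b, ∀ t ∈ Set.uIcc a b,
      dist (k s) (k t) ≤ K * (dist (f s) (f t) + dist s t)) :
    AbsolutelyContinuousOnInterval k a b := by
  have hid : AbsolutelyContinuousOnInterval (fun s : ℝ => s) a b :=
    (LipschitzWith.id.lipschitzOnWith (s := Set.uIcc a b)).absolutelyContinuousOnInterval
  unfold AbsolutelyContinuousOnInterval at hf hid ⊢
  refine squeeze_zero' (Filter.Eventually.of_forall fun _ => Finset.sum_nonneg fun _ _ =>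
    dist_nonneg) ?_ (by simpa using (hf.add hid).const_mul K)
  rw [Filter.eventually_inf_principal]
  filter_upwards with E hE
  rw [← Finset.sum_add_distrib, Finset.mul_sum]
  exact Finset.sum_le_sum fun i hi => hk _ (hE.1 i hi).1 _ (hE.1 i hi).2

lemma absolutelyContinuousOnInterval_sub_le {f g : ℝ → ℝ} {a b : ℝ} (hab : a ≤ b)
    (hf : AbsolutelyContinuousOnInterval f a b) (hg : IntervalIntegrable g volume a b)
    (h : ∀ᵐ s, s ∈ Set.Ioo a b → deriv f s ≤ g s) : f b - f a ≤ ∫ s in a..b, g s := by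
  rw [← hf.integral_deriv_eq_sub]
  refine intervalIntegral.integral_mono_ae_restrict hab hf.intervalIntegrable_deriv hg ?_
  rw [← restrict_Ioo_eq_restrict_Icc]
  exact (ae_restrict_iff' measurableSet_Ioo).2 h

end AbsolutelyContinuous

/-! ### The running cost along curves -/

section Cost

open MeasureTheory

variable {N m : ℕ} {H : Torus N → E N → (Fin m → ℝ) → ℝ} {Θ : ℝ}

/-- The running cost `L(x, v, u(x, s))`, lifted to `ℝ^N`. -/
def cost (H : Torus N → E N → (Fin m → ℝ) → ℝ) (u : C(Torus N × ℝ≥0, Fin m → ℝ))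
    (x v : E N) (s : ℝ) : ℝ :=
  lagrangian H (proj x) v (u (proj x, s.toNNReal))

lemma continuous_lift (u : C(Torus N × ℝ≥0, Fin m → ℝ)) :
    Continuous fun q : E N × ℝ => u (proj q.1, q.2.toNNReal) :=
  u.continuous.comp (((continuous_proj N).comp continuous_fst).prodMk
    (continuous_real_toNNReal.comp continuous_snd))

lemma exists_bound_le_time (u : C(Torus N × ℝ≥0, Fin m → ℝ)) (T : ℝ) :
    ∃ B, 0 ≤ B ∧ ∀ x (s : ℝ), s ≤ T → ‖u (x, s.toNNReal)‖ ≤ B := by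
  obtain ⟨B, hB⟩ := ((isCompact_univ (X := Torus N)).prod
    (isCompact_Icc (a := (0 : ℝ≥0)) (b := T.toNNReal))).exists_bound_of_continuousOn
    u.continuous.continuousOn
  refine ⟨max B 0, le_max_right _ _, fun x s hs => (hB (x, s.toNNReal) ⟨trivial, ?_⟩).trans
    (le_max_left _ _)⟩
  exact ⟨zero_le, Real.toNNReal_le_toNNReal hs⟩

lemma IsAdmissible.continuous_cost (hH : IsAdmissible H) (u : C(Torus N × ℝ≥0, Fin m → ℝ)) :
    Continuous fun q : E N × E N × ℝ => cost H u q.1 q.2.1 q.2.2 := by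
  have h1 : Continuous fun q : E N × E N × ℝ => u (proj q.1, q.2.2.toNNReal) :=
    (continuous_lift u).comp (f := fun q : E N × E N × ℝ => (q.1, q.2.2)) (by fun_prop)
  have h2 : Continuous fun q : E N × E N × ℝ => proj q.1 := (continuous_proj N).comp continuous_fst
  exact hH.continuous_lagrangian.comp
    (f := fun q : E N × E N × ℝ => (proj q.1, q.2.1, u (proj q.1, q.2.2.toNNReal)))
    (h2.prodMk ((by fun_prop : Continuous fun q : E N × E N × ℝ => q.2.1).prodMk h1))

lemma IsAdmissible.exists_cost_ge (hH : IsAdmissible H) (u : C(Torus N × ℝ≥0, Fin m → ℝ))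
    {A : ℝ} (hA : 0 ≤ A) (T : ℝ) :
    ∃ C, 0 ≤ C ∧ ∀ x v s, s ≤ T → A * ‖v‖ - C ≤ cost H u x v s := by
  obtain ⟨Θ, hΘ0, hΘ⟩ := hH.lipschitz
  obtain ⟨B, hB0, hB⟩ := exists_bound_le_time u T
  obtain ⟨C, hC0, hC⟩ := hH.exists_lagrangian_ge hΘ hA
  refine ⟨C + Θ * B, by positivity, fun x v s hs => ?_⟩
  have h1 := hC (proj x) v (u (proj x, s.toNNReal))
  have h2 : Θ * ‖u (proj x, s.toNNReal)‖ ≤ Θ * B := by gcongr; exact hB _ s hs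
  unfold cost
  linarith

lemma IsAdmissible.exists_cost_le (hH : IsAdmissible H) (u : C(Torus N × ℝ≥0, Fin m → ℝ))
    (R T : ℝ) : ∃ C, 0 ≤ C ∧ ∀ x v s, ‖v‖ ≤ R → s ≤ T → cost H u x v s ≤ C := by
  obtain ⟨B, hB0, hB⟩ := exists_bound_le_time u T
  obtain ⟨C, hC⟩ := ((isCompact_univ (X := Torus N)).prod
    ((isCompact_closedBall (0 : E N) R).prod
      (isCompact_closedBall (0 : Fin m → ℝ) B))).exists_bound_of_continuousOn
    hH.continuous_lagrangian.continuousOn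
  refine ⟨max C 0, le_max_right _ _, fun x v s hv hs => ?_⟩
  refine ((le_abs_self _).trans (hC (proj x, v, u (proj x, s.toNNReal)) ⟨trivial, ?_, ?_⟩)).trans
    (le_max_left _ _)
  · simpa using hv
  · simpa using hB _ s hs

lemma aestronglyMeasurable_comp_curve {F : E N × E N × ℝ → ℝ} (hF : Continuous F)
    {γ : ℝ → E N} {a b : ℝ}
    (hγ : ContinuousOn γ (Set.uIcc a b)) :
    AEStronglyMeasurable (fun s => F (γ s, deriv γ s, s)) (volume.restrict (Set.uIoc a b)) := by
  have h1 : AEStronglyMeasurable γ (volume.restrict (Set.uIoc a b)) :=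
    (hγ.mono Set.uIoc_subset_uIcc).aestronglyMeasurable measurableSet_uIoc
  have h2 : AEStronglyMeasurable (deriv γ) (volume.restrict (Set.uIoc a b)) :=
    (stronglyMeasurable_deriv γ).aestronglyMeasurable
  have h3 : AEStronglyMeasurable (fun s : ℝ => s) (volume.restrict (Set.uIoc a b)) :=
    continuous_id.aestronglyMeasurable
  exact hF.comp_aestronglyMeasurable (h1.prodMk (h2.prodMk h3))

lemma IsAdmissible.aestronglyMeasurable_lagrangianAlong (hH : IsAdmissible H)
    (u : C(Torus N × ℝ≥0, Fin m → ℝ)) {γ : ℝ → E N} {a b : ℝ}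
    (hγ : ContinuousOn γ (Set.uIcc a b)) :
    AEStronglyMeasurable (lagrangianAlong H u γ) (volume.restrict (Set.uIoc a b)) :=
  aestronglyMeasurable_comp_curve (hH.continuous_cost u) hγ

/-- The action of a time-shifted curve with respect to a nearby coupling. -/
lemma IsAdmissible.shift_action (hH : IsAdmissible H) (hΘ : LipschitzInU H Θ)
    {u u' : C(Torus N × ℝ≥0, Fin m → ℝ)} {γ : ℝ → E N} {t h : ℝ} (hΘ0 : 0 ≤ Θ) (ht : 0 ≤ t)
    (hh : 0 ≤ h) (hγ : AbsolutelyContinuousOnInterval γ 0 (t + h))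
    (hinteg : IntervalIntegrable (lagrangianAlong H u γ) volume 0 (t + h))
    {g : ℝ → ℝ} (hg : Continuous g)
    (hug : ∀ x, ∀ s ∈ Set.Icc 0 t, ‖u' (x, s.toNNReal) - u (x, (s + h).toNNReal)‖ ≤ g s) :
    AbsolutelyContinuousOnInterval (fun s => γ (s + h)) 0 t ∧
    IntervalIntegrable (lagrangianAlong H u' fun s => γ (s + h)) volume 0 t ∧
    ∫ s in (0 : ℝ)..t, lagrangianAlong H u' (fun s => γ (s + h)) s ≤
      (∫ s in h..(t + h), lagrangianAlong H u γ s) + Θ * ∫ s in (0 : ℝ)..t, g s := by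
  have hac : AbsolutelyContinuousOnInterval (fun s => γ (s + h)) 0 t := by
    refine absolutelyContinuousOnInterval_comp_monotone (g := fun s => s + h) hγ
      (fun x y hxy => by simpa using hxy) (fun x y => by simp) fun x hx => ?_
    rw [Set.uIcc_of_le ht] at hx
    rw [Set.uIcc_of_le (by linarith)]
    exact ⟨by linarith [hx.1], by linarith [hx.2]⟩
  have hclose : ∀ s ∈ Set.Icc 0 t, |lagrangianAlong H u' (fun s => γ (s + h)) s -
      lagrangianAlong H u γ (s + h)| ≤ Θ * g s := by
    intro s hs
    simp only [lagrangianAlong, deriv_comp_add_const]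
    refine (hH.lagrangian_sub_le hΘ _ _ _ _).trans ?_
    gcongr
    exact hug _ s hs
  have hsub : IntervalIntegrable (lagrangianAlong H u γ) volume h (t + h) :=
    hinteg.mono_set (by
      rw [Set.uIcc_of_le (by linarith), Set.uIcc_of_le (by linarith)]
      exact Set.Icc_subset_Icc_left hh)
  have hi1 : IntervalIntegrable (fun s => lagrangianAlong H u γ (s + h)) volume 0 t := by
    have := hsub.comp_add_right h
    simpa using this
  have hi2 : IntervalIntegrable (fun s => Θ * g s) volume 0 t :=
    (hg.const_mul Θ).intervalIntegrable 0 t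
  have hi3 : IntervalIntegrable (lagrangianAlong H u' fun s => γ (s + h)) volume 0 t := by
    refine (hi1.norm.add hi2).mono_fun' (hH.aestronglyMeasurable_lagrangianAlong u' hac.continuousOn)
      ?_
    rw [Filter.EventuallyLE, ae_restrict_iff' measurableSet_uIoc]
    refine Filter.Eventually.of_forall fun s hs => ?_
    rw [Set.uIoc_of_le ht] at hs
    have h1 := hclose s ⟨hs.1.le, hs.2⟩
    simp only [Real.norm_eq_abs]
    have h2 := abs_sub_abs_le_abs_sub (lagrangianAlong H u' (fun s => γ (s + h)) s)
      (lagrangianAlong H u γ (s + h))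
    linarith
  refine ⟨hac, hi3, ?_⟩
  have h4 : ∫ s in (0 : ℝ)..t, lagrangianAlong H u' (fun s => γ (s + h)) s ≤
      ∫ s in (0 : ℝ)..t, (lagrangianAlong H u γ (s + h) + Θ * g s) := by
    refine intervalIntegral.integral_mono_on ht hi3 (hi1.add hi2) fun s hs => ?_
    linarith [(abs_le.1 (hclose s hs)).2]
  rw [intervalIntegral.integral_add hi1 hi2, intervalIntegral.integral_const_mul,
    intervalIntegral.integral_comp_add_right (lagrangianAlong H u γ) h, zero_add] at h4
  exact h4

/-- Superlinearity: the displacement of a curve is controlled by its action. -/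
lemma norm_sub_le_action (u : C(Torus N × ℝ≥0, Fin m → ℝ)) {γ : ℝ → E N} {a b A C : ℝ}
    (hab : a ≤ b) (hA : 0 ≤ A) (hγ : AbsolutelyContinuousOnInterval γ a b)
    (hinteg : IntervalIntegrable (lagrangianAlong H u γ) volume a b)
    (hC : ∀ x v s, s ≤ b → A * ‖v‖ - C ≤ cost H u x v s) :
    A * ‖γ b - γ a‖ ≤ (∫ s in a..b, lagrangianAlong H u γ s) + C * (b - a) := by
  -- The direction of the displacement, reducing to the scalar function `⟨e, γ⟩`. If the endpoints
  -- agree then `e = 0`, so only `‖e‖ ≤ 1` is claimed.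
  set e : E N := ‖γ b - γ a‖⁻¹ • (γ b - γ a) with he
  have he1 : ‖e‖ ≤ 1 := by
    rw [he, norm_smul, norm_inv, norm_norm]
    exact inv_mul_le_one
  have hac : AbsolutelyContinuousOnInterval (fun s => A * inner ℝ e (γ s)) a b := by
    refine absolutelyContinuousOnInterval_of_dist_le (K := A) hγ fun s _ t _ => ?_
    rw [Real.dist_eq, ← mul_sub, ← inner_sub_right, abs_mul, abs_of_nonneg hA]
    gcongr
    calc |inner ℝ e (γ s - γ t)| ≤ ‖e‖ * ‖γ s - γ t‖ := abs_real_inner_le_norm _ _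
      _ ≤ 1 * ‖γ s - γ t‖ := by gcongr
      _ ≤ dist (γ s) (γ t) + dist s t := by
        rw [one_mul, dist_eq_norm]; linarith [dist_nonneg (x := s) (y := t)]
  have hdiff := hγ.boundedVariationOn.ae_differentiableAt_of_mem_uIcc
  have h1 := absolutelyContinuousOnInterval_sub_le hab hac
    (hinteg.add (intervalIntegrable_const (c := C))) (by
      filter_upwards [hdiff] with s hs hs'
      have hd := (hs (by rw [Set.uIcc_of_le hab]; exact ⟨hs'.1.le, hs'.2.le⟩)).hasDerivAt
      have h2 : HasDerivAt (fun s => A * inner ℝ e (γ s)) (A * inner ℝ e (deriv γ s)) s := by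
        simpa using ((hasDerivAt_const s e).inner ℝ hd).const_mul A
      rw [h2.deriv]
      have h3 := hC (γ s) (deriv γ s) s hs'.2.le
      have h4 : inner ℝ e (deriv γ s) ≤ ‖deriv γ s‖ := by
        calc inner ℝ e (deriv γ s) ≤ ‖e‖ * ‖deriv γ s‖ := real_inner_le_norm _ _
          _ ≤ 1 * ‖deriv γ s‖ := by gcongr
          _ = _ := one_mul _
      have h5 : A * inner ℝ e (deriv γ s) ≤ A * ‖deriv γ s‖ := by gcongr
      change _ ≤ lagrangianAlong H u γ s + C
      unfold cost at h3
      unfold lagrangianAlong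
      linarith)
  have h2 : A * inner ℝ e (γ b) - A * inner ℝ e (γ a) = A * ‖γ b - γ a‖ := by
    rw [← mul_sub, ← inner_sub_right, he, real_inner_smul_left, real_inner_self_eq_norm_sq]
    congr 1
    rcases eq_or_ne ‖γ b - γ a‖ 0 with h | h
    · simp [h]
    · field_simp
  rw [h2] at h1
  refine h1.trans (le_of_eq ?_)
  rw [intervalIntegral.integral_add hinteg intervalIntegrable_const]
  simp [mul_comm]

/-- Extending a curve by a segment of constant velocity `v`. -/
lemma IsAdmissible.extend_action (hH : IsAdmissible H) (u : C(Torus N × ℝ≥0, Fin m → ℝ))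
    {γ : ℝ → E N} {s t : ℝ} (hs : 0 ≤ s) (hst : s ≤ t)
    (hγ : AbsolutelyContinuousOnInterval γ 0 s)
    (hinteg : IntervalIntegrable (lagrangianAlong H u γ) volume 0 s) (v : E N) :
    ∃ η : ℝ → E N, AbsolutelyContinuousOnInterval η 0 t ∧ η 0 = γ 0 ∧
      η t = γ s + (t - s) • v ∧ IntervalIntegrable (lagrangianAlong H u η) volume 0 t ∧
      ∫ r in (0 : ℝ)..t, lagrangianAlong H u η r =
        (∫ r in (0 : ℝ)..s, lagrangianAlong H u γ r) +
        ∫ r in s..t, cost H u (γ s + (r - s) • v) v r := by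
  -- The concatenation is written as a sum of a reparametrized curve and a Lipschitz function, so
  -- absolute continuity needs no gluing. Velocities agree only on the open intervals, the corner at
  -- `s` being negligible for the integrals.
  set η : ℝ → E N := fun r => γ (min r s) + (max r s - s) • v with hη
  have hac : AbsolutelyContinuousOnInterval η 0 t := by
    refine AbsolutelyContinuousOnInterval.add
      (f := fun r => γ (min r s)) (g := fun r => (max r s - s) • v) ?_ ?_
    · refine absolutelyContinuousOnInterval_comp_monotone (g := fun r => min r s) hγ
        (fun x y hxy => min_le_min_right s hxy) (fun x y => ?_) fun x hx => ?_
      · simp only [Real.dist_eq]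
        exact (abs_min_sub_min_le_max x s y s).trans (by simp)
      · rw [Set.uIcc_of_le (by linarith)] at hx
        rw [Set.uIcc_of_le hs]
        exact ⟨le_min hx.1 hs, min_le_right _ _⟩
    · refine (LipschitzOnWith.of_dist_le_mul (K := ‖v‖₊) fun x _ y _ => ?_
        ).absolutelyContinuousOnInterval
      rw [dist_eq_norm, ← sub_smul, norm_smul, mul_comm]
      simp only [coe_nnnorm]
      gcongr
      rw [Real.norm_eq_abs, Real.dist_eq, sub_sub_sub_cancel_right]
      exact (abs_max_sub_max_le_max x s y s).trans (by simp)
  have hl : Set.EqOn (lagrangianAlong H u γ) (lagrangianAlong H u η) (Set.uIoo 0 s) := by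
    intro r hr
    rw [Set.uIoo_of_le hs] at hr
    have h1 : η =ᶠ[nhds r] γ := by
      filter_upwards [Iio_mem_nhds hr.2] with q hq
      have hq' : q ≤ s := le_of_lt hq
      simp [hη, hq']
    simp only [lagrangianAlong]
    rw [h1.deriv_eq, h1.eq_of_nhds]
  have hr : Set.EqOn (fun r => cost H u (γ s + (r - s) • v) v r) (lagrangianAlong H u η)
      (Set.uIoo s t) := by
    intro r hr
    rw [Set.uIoo_of_le hst] at hr
    have h1 : η =ᶠ[nhds r] fun r => γ s + (r - s) • v := by
      filter_upwards [Ioi_mem_nhds hr.1] with q hq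
      have hq' : s ≤ q := le_of_lt hq
      simp [hη, hq']
    have h2 : HasDerivAt (fun r => γ s + (r - s) • v) v r := by
      simpa using (((hasDerivAt_id r).sub_const s).smul_const v).const_add (γ s)
    simp only [lagrangianAlong, cost]
    rw [h1.deriv_eq, h1.eq_of_nhds, h2.deriv]
  have hc : Continuous fun r => cost H u (γ s + (r - s) • v) v r :=
    (hH.continuous_cost u).comp (f := fun r : ℝ => (γ s + (r - s) • v, v, r)) (by fun_prop)
  have hi1 := hinteg.congr_uIoo hl
  have hi2 := (hc.intervalIntegrable (μ := volume) s t).congr_uIoo hr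
  refine ⟨η, hac, by simp [hη, hs], by simp [hη, hst], hi1.trans hi2, ?_⟩
  rw [← intervalIntegral.integral_add_adjacent_intervals hi1 hi2,
    intervalIntegral.integral_congr_uIoo hl, intervalIntegral.integral_congr_uIoo hr]

end Cost

/-! ### The value function -/

section Value

open MeasureTheory

variable {N m : ℕ} {H : Fin m → Torus N → E N → (Fin m → ℝ) → ℝ} {φ : C(Torus N, Fin m → ℝ)}
  {u u' : C(Torus N × ℝ≥0, Fin m → ℝ)} {i : Fin m} {Θ : ℝ}

/-- The values of the action over the curves in `ℝ^N` that end exactly at `x` at time `t`. -/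
def actions (H : Fin m → Torus N → E N → (Fin m → ℝ) → ℝ) (φ : C(Torus N, Fin m → ℝ))
    (u : C(Torus N × ℝ≥0, Fin m → ℝ)) (i : Fin m) (x : E N) (t : ℝ) : Set ℝ :=
  {a | ∃ γ : ℝ → E N, AbsolutelyContinuousOnInterval γ 0 t ∧ γ t = x ∧
    IntervalIntegrable (lagrangianAlong (H i) u γ) volume 0 t ∧
    a = φ (proj (γ 0)) i + ∫ s in (0 : ℝ)..t, lagrangianAlong (H i) u γ s}

/-- The value function, lifted to `ℝ^N`. -/
def value (H : Fin m → Torus N → E N → (Fin m → ℝ) → ℝ) (φ : C(Torus N, Fin m → ℝ))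
    (u : C(Torus N × ℝ≥0, Fin m → ℝ)) (i : Fin m) (x : E N) (t : ℝ) : ℝ :=
  sInf (actions H φ u i x t)

/-- A lift whose endpoint projects to the right point can be translated by a lattice vector to end
exactly at `x`, without changing its action. -/
lemma actionValues_proj (x : E N) (t : ℝ≥0) :
    actionValues H φ u i (proj x) t = actions H φ u i x t := by
  ext a
  constructor
  · rintro ⟨γ, hγ, hx, hinteg, ha⟩
    set k : E N := x - γ t with hk
    have hk0 : proj k = 0 := by rw [hk, proj_sub, hx, sub_self]
    have hp : ∀ s, proj (γ s + k) = proj (γ s) := fun s => by rw [proj_add, hk0, add_zero]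
    have hl : lagrangianAlong (H i) u (fun s => γ s + k) = lagrangianAlong (H i) u γ := by
      funext s
      simp only [lagrangianAlong, hp, deriv_add_const]
    refine ⟨fun s => γ s + k, ?_, by simp [hk], by rwa [hl], by simp only [hl, hp, ha]⟩
    exact absolutelyContinuousOnInterval_of_dist_le (K := 1) hγ fun s _ r _ => by simp
  · rintro ⟨γ, hγ, hx, hinteg, ha⟩
    exact ⟨γ, hγ, by rw [hx], hinteg, ha⟩

lemma isGLB_value (hH : IsAdmissible (H i)) (x : E N) {t : ℝ} (ht : 0 ≤ t) :
    IsGLB (actions H φ u i x t) (value H φ u i x t) := by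
  refine isGLB_csInf ?_ ?_
  · refine ⟨_, fun _ => x, (LipschitzWith.const x).lipschitzOnWith.absolutelyContinuousOnInterval,
      rfl, ?_, rfl⟩
    have hc : Continuous fun s => cost (H i) u x 0 s :=
      (hH.continuous_cost u).comp (f := fun s : ℝ => (x, (0 : E N), s)) (by fun_prop)
    have : lagrangianAlong (H i) u (fun _ => x) = fun s => cost (H i) u x 0 s := by
      funext s; simp [lagrangianAlong, cost]
    rw [this]
    exact hc.intervalIntegrable 0 t
  · obtain ⟨C, hC0, hC⟩ := hH.exists_cost_ge u le_rfl t
    refine ⟨-‖φ‖ - C * t, ?_⟩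
    rintro _ ⟨γ, hγ, -, hinteg, rfl⟩
    have h1 := norm_sub_le_action u ht le_rfl hγ hinteg hC
    have h2 : |φ (proj (γ 0)) i| ≤ ‖φ‖ :=
      (norm_le_pi_norm (φ (proj (γ 0))) i).trans (φ.norm_coe_le_norm _)
    have h3 := abs_le.1 h2
    simp only [zero_mul, sub_zero] at h1
    linarith

lemma value_le_of_curve (hH : IsAdmissible (H i)) {γ : ℝ → E N} {t : ℝ} (ht : 0 ≤ t)
    (hγ : AbsolutelyContinuousOnInterval γ 0 t)
    (hinteg : IntervalIntegrable (lagrangianAlong (H i) u γ) volume 0 t) :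
    value H φ u i (γ t) t ≤
      φ (proj (γ 0)) i + ∫ s in (0 : ℝ)..t, lagrangianAlong (H i) u γ s :=
  (isGLB_value hH (γ t) ht).1 ⟨γ, hγ, rfl, hinteg, rfl⟩

lemma exists_near_optimal (hH : IsAdmissible (H i)) (x : E N) {t ε : ℝ} (ht : 0 ≤ t)
    (hε : 0 < ε) :
    ∃ γ : ℝ → E N, AbsolutelyContinuousOnInterval γ 0 t ∧ γ t = x ∧
      IntervalIntegrable (lagrangianAlong (H i) u γ) volume 0 t ∧
      φ (proj (γ 0)) i + ∫ s in (0 : ℝ)..t, lagrangianAlong (H i) u γ s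
        < value H φ u i x t + ε := by
  obtain ⟨_, ⟨γ, h1, h2, h3, rfl⟩, -, h5⟩ :=
    (isGLB_value (φ := φ) (u := u) hH x ht).exists_between (lt_add_of_pos_right _ hε)
  exact ⟨γ, h1, h2, h3, h5⟩

lemma value_zero (hH : IsAdmissible (H i)) (x : E N) : value H φ u i x 0 = φ (proj x) i := by
  have h := isGLB_value (φ := φ) (u := u) hH x le_rfl
  have : actions H φ u i x 0 = {φ (proj x) i} := by
    ext a
    constructor
    · rintro ⟨γ, -, hx, -, rfl⟩
      simp [hx]
    · rintro rfl
      exact ⟨fun _ => x, (LipschitzWith.const x).lipschitzOnWith.absolutelyContinuousOnInterval,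
        rfl, by simp, by simp⟩
  rw [this] at h
  exact h.unique isGLB_singleton

/-- The easy half of dynamic programming, for straight segments: append the segment to an arbitrary
competitor up to time `s`. -/
lemma value_le_segment (hH : IsAdmissible (H i)) (x v : E N) {s t : ℝ} (hs : 0 ≤ s)
    (hst : s ≤ t) :
    value H φ u i (x + (t - s) • v) t ≤
      value H φ u i x s + ∫ r in s..t, cost (H i) u (x + (r - s) • v) v r := by
  rw [← sub_le_iff_le_add]
  refine (isGLB_value hH x hs).2 ?_
  rintro _ ⟨γ, hγ, hx, hinteg, rfl⟩
  obtain ⟨η, h1, h2, h3, h4, h5⟩ := hH.extend_action u hs hst hγ hinteg v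
  have h6 := value_le_of_curve (φ := φ) hH (hs.trans hst) h1 h4
  rw [h5, h3, h2, hx] at h6
  linarith

/-- A displacement not exceeding the elapsed time can be made at speed at most one, where the cost
is bounded. This is the source of all upper bounds for increments of the value function. -/
lemma value_le_move (hH : IsAdmissible (H i)) {C T : ℝ}
    (hC : ∀ x v s, ‖v‖ ≤ 1 → s ≤ T → cost (H i) u x v s ≤ C) {x y : E N} {s t : ℝ}
    (hs : 0 ≤ s) (hst : s ≤ t) (htT : t ≤ T) (hxy : ‖y - x‖ ≤ t - s) :
    value H φ u i y t ≤ value H φ u i x s + C * (t - s) := by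
  set v : E N := (t - s)⁻¹ • (y - x) with hv
  have hy : x + (t - s) • v = y := by
    rcases hst.eq_or_lt with rfl | h
    · have : y = x := by simpa [sub_eq_zero] using hxy
      simp [this]
    · have : t - s ≠ 0 := by linarith
      rw [hv, smul_smul, mul_inv_cancel₀ this, one_smul]; abel
  have hv1 : ‖v‖ ≤ 1 := by
    have h0 : 0 ≤ t - s := by linarith
    rw [hv, norm_smul, norm_inv, Real.norm_of_nonneg h0]
    calc (t - s)⁻¹ * ‖y - x‖ ≤ (t - s)⁻¹ * (t - s) := by gcongr
      _ ≤ 1 := inv_mul_le_one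
  have h1 := value_le_segment (φ := φ) (u := u) hH x v hs hst
  rw [hy] at h1
  have hc : Continuous fun r => cost (H i) u (x + (r - s) • v) v r :=
    (hH.continuous_cost u).comp (f := fun r : ℝ => (x + (r - s) • v, v, r)) (by fun_prop)
  have h2 : ∫ r in s..t, cost (H i) u (x + (r - s) • v) v r ≤ ∫ _ in s..t, C :=
    intervalIntegral.integral_mono_on hst (hc.intervalIntegrable s t) intervalIntegrable_const
      fun r hr => hC _ _ _ hv1 (hr.2.trans htT)
  rw [intervalIntegral.integral_const, smul_eq_mul] at h2
  linarith

/-- Each curve has nearly the same action for both couplings, because `L` inherits from `H` the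
Lipschitz constant `Θ` in `u`. -/
lemma value_le_of_coupling (hH : IsAdmissible (H i)) (hΘ : LipschitzInU (H i) Θ) (hΘ0 : 0 ≤ Θ)
    (x : E N) {t : ℝ} (ht : 0 ≤ t) {g : ℝ → ℝ} (hg : Continuous g)
    (hug : ∀ x, ∀ s ∈ Set.Icc 0 t, ‖u' (x, s.toNNReal) - u (x, s.toNNReal)‖ ≤ g s) :
    value H φ u' i x t ≤ value H φ u i x t + Θ * ∫ s in (0 : ℝ)..t, g s := by
  rw [← sub_le_iff_le_add]
  refine (isGLB_value hH x ht).2 ?_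
  rintro _ ⟨γ, hγ, hx, hinteg, rfl⟩
  obtain ⟨h1, h2, h3⟩ := hH.shift_action (h := 0) (u' := u') hΘ hΘ0 ht le_rfl (by simpa using hγ)
    (by simpa using hinteg) hg (by simpa using hug)
  simp only [add_zero] at h1 h2 h3
  have h4 := value_le_of_curve (φ := φ) hH ht h1 h2
  rw [hx] at h4
  linarith

/-- Discard the part of a competitor on `[0, h]` and start the rest at time zero. The datum then
changes by at most `κ + K ‖γ h - γ 0‖`; since the cost has slope at least `K`, the discarded action
pays for the displacement up to `C * h`. The remaining term compares `u` at times `s` and `s + h`.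
-/
lemma value_le_shift (hH : IsAdmissible (H i)) (hΘ : LipschitzInU (H i) Θ) (hΘ0 : 0 ≤ Θ)
    (x : E N) {t h K κ C : ℝ} (ht : 0 ≤ t) (hh : 0 ≤ h) (hK : 0 ≤ K)
    (hφ : ∀ x y, φ (proj x) i - φ (proj y) i ≤ κ + K * ‖x - y‖)
    (hC : ∀ x v s, s ≤ t + h → K * ‖v‖ - C ≤ cost (H i) u x v s)
    {g : ℝ → ℝ} (hg : Continuous g)
    (hug : ∀ x, ∀ s ∈ Set.Icc 0 t, ‖u (x, s.toNNReal) - u (x, (s + h).toNNReal)‖ ≤ g s) :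
    value H φ u i x t ≤
      value H φ u i x (t + h) + (κ + C * h + Θ * ∫ s in (0 : ℝ)..t, g s) := by
  rw [← sub_le_iff_le_add]
  refine (isGLB_value hH x (add_nonneg ht hh)).2 ?_
  rintro _ ⟨γ, hγ, hx, hinteg, rfl⟩
  obtain ⟨h1, h2, h3⟩ := hH.shift_action hΘ hΘ0 ht hh hγ hinteg hg hug
  have h4 := value_le_of_curve (φ := φ) hH ht h1 h2
  simp only [zero_add] at h4
  rw [hx] at h4
  have hsub : Set.uIcc 0 h ⊆ Set.uIcc 0 (t + h) := by
    rw [Set.uIcc_of_le hh, Set.uIcc_of_le (by linarith)]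
    exact Set.Icc_subset_Icc_right (by linarith)
  have hsub' : Set.uIcc h (t + h) ⊆ Set.uIcc 0 (t + h) := by
    rw [Set.uIcc_of_le (by linarith), Set.uIcc_of_le (by linarith)]
    exact Set.Icc_subset_Icc_left hh
  have h5 := norm_sub_le_action u hh hK (hγ.mono hsub) (hinteg.mono_set hsub)
    fun x v s hs => hC x v s (by linarith)
  have h6 := hφ (γ h) (γ 0)
  rw [← intervalIntegral.integral_add_adjacent_intervals (hinteg.mono_set hsub)
    (hinteg.mono_set hsub')]
  linarith

lemma exists_time_modulus (u : C(Torus N × ℝ≥0, Fin m → ℝ)) (T : ℝ) {ε : ℝ} (hε : 0 < ε) :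
    ∃ δ > 0, ∀ x s h, 0 ≤ s → 0 ≤ h → h ≤ δ → s + h ≤ T →
      ‖u (x, s.toNNReal) - u (x, (s + h).toNNReal)‖ ≤ ε := by
  have hK : IsCompact ((Set.univ : Set (Torus N)) ×ˢ Set.Icc (0 : ℝ≥0) T.toNNReal) :=
    isCompact_univ.prod isCompact_Icc
  obtain ⟨δ, hδ, h⟩ := Metric.uniformContinuousOn_iff.1
    (hK.uniformContinuousOn_of_continuous u.continuous.continuousOn) ε hε
  refine ⟨δ / 2, by positivity, fun x s r hs hr hrδ hT => ?_⟩
  rw [← dist_eq_norm]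
  refine (h _ ⟨trivial, zero_le, Real.toNNReal_le_toNNReal (by linarith)⟩ _
    ⟨trivial, zero_le, Real.toNNReal_le_toNNReal hT⟩ ?_).le
  rw [Prod.dist_eq, dist_self, max_eq_right dist_nonneg, NNReal.dist_eq,
    Real.coe_toNNReal _ hs, Real.coe_toNNReal _ (by linarith), abs_sub_comm]
  rw [add_sub_cancel_left, abs_of_nonneg hr]
  linarith

lemma value_time_modulus (hH : IsAdmissible (H i)) (T : ℝ) {ε : ℝ} (hε : 0 < ε) :
    ∃ δ > 0, ∀ x t h, 0 ≤ t → 0 ≤ h → h ≤ δ → t + h ≤ T →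
      |value H φ u i x (t + h) - value H φ u i x t| ≤ ε := by
  obtain ⟨Θ, hΘ0, hΘ⟩ := hH.lipschitz
  obtain ⟨C, hC0, hC⟩ := hH.exists_cost_le u 1 T
  obtain ⟨K, hK0, hK⟩ := exists_modulus_datum φ (κ := ε / 3) (by positivity)
  obtain ⟨D, hD0, hD⟩ := hH.exists_cost_ge u hK0 T
  have hη : 0 < ε / (3 * Θ * (|T| + 1)) := by positivity
  obtain ⟨δ, hδ, hu⟩ := exists_time_modulus u T hη
  refine ⟨min δ (ε / (3 * (C + D + 1))), by positivity, fun x t h ht hh hhδ hT => ?_⟩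
  have hh1 := hhδ.trans (min_le_left _ _)
  have hh2 := hhδ.trans (min_le_right _ _)
  rw [le_div_iff₀ (by positivity)] at hh2
  have h1 := value_le_move (φ := φ) hH hC (x := x) (y := x) ht (by linarith : t ≤ t + h) hT
    (by simpa using hh)
  have h2 := value_le_shift (φ := φ) hH hΘ hΘ0.le x ht hh hK0 (fun x y => hK x y i)
    (fun x v s hs => hD x v s (hs.trans hT)) (g := fun _ => ε / (3 * Θ * (|T| + 1)))
    continuous_const (fun x s hs => hu x s h hs.1 hh hh1 (by linarith [hs.2]))
  rw [intervalIntegral.integral_const, smul_eq_mul, sub_zero] at h2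
  have h3 : Θ * (t * (ε / (3 * Θ * (|T| + 1)))) ≤ ε / 3 := by
    have : t ≤ |T| + 1 := by linarith [le_abs_self T]
    calc Θ * (t * (ε / (3 * Θ * (|T| + 1))))
        ≤ Θ * ((|T| + 1) * (ε / (3 * Θ * (|T| + 1)))) := by gcongr
      _ = ε / 3 := by field_simp
  have h4 : C * h ≤ ε / 3 := by nlinarith
  have h5 : D * h ≤ ε / 3 := by nlinarith
  rw [add_sub_cancel_left] at h1
  rw [abs_le]
  constructor <;> linarith

/-- At positive time, step back in time by `‖y - x‖` at `x` and move to `y` at unit speed; this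
reduces the spatial modulus to the temporal one. At time zero it is the modulus of the datum. -/
lemma value_space_modulus (hH : IsAdmissible (H i)) {t : ℝ} (ht : 0 ≤ t) {ε : ℝ} (hε : 0 < ε) :
    ∃ δ > 0, ∀ x y : E N, ‖y - x‖ < δ → value H φ u i y t ≤ value H φ u i x t + ε := by
  rcases ht.eq_or_lt with rfl | ht0
  · obtain ⟨K, hK0, hK⟩ := exists_modulus_datum φ (κ := ε / 2) (by positivity)
    refine ⟨ε / (2 * (K + 1)), by positivity, fun x y hxy => ?_⟩
    rw [value_zero hH, value_zero hH]
    rw [lt_div_iff₀ (by positivity)] at hxy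
    have := hK y x i
    nlinarith [norm_nonneg (y - x)]
  · obtain ⟨C, hC0, hC⟩ := hH.exists_cost_le u 1 t
    obtain ⟨δ, hδ, hd⟩ := value_time_modulus (φ := φ) (u := u) hH t (half_pos hε)
    refine ⟨min (min δ t) (ε / (2 * (C + 1))), by positivity, fun x y hxy => ?_⟩
    obtain ⟨hxy1, hxy2⟩ := lt_min_iff.1 hxy
    obtain ⟨hxyδ, hxyt⟩ := lt_min_iff.1 hxy1
    rw [lt_div_iff₀ (by positivity)] at hxy2
    have h1 := value_le_move (φ := φ) hH hC (x := x) (y := y) (s := t - ‖y - x‖) (t := t)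
      (by linarith) (by linarith [norm_nonneg (y - x)]) le_rfl (by simp)
    have h2 := hd x (t - ‖y - x‖) ‖y - x‖ (by linarith) (norm_nonneg _) hxyδ.le (by simp)
    rw [sub_add_cancel] at h2
    rw [sub_sub_cancel] at h1
    nlinarith [(abs_le.1 h2).1, norm_nonneg (y - x)]

lemma continuous_value (hH : IsAdmissible (H i)) :
    Continuous fun q : E N × ℝ≥0 => value H φ u i q.1 q.2 := by
  rw [Metric.continuous_iff]
  rintro ⟨x, t⟩ ε hε
  obtain ⟨δ, hδ, hd⟩ := value_time_modulus (φ := φ) (u := u) hH (t + 1) (ε := ε / 3) (by positivity)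
  obtain ⟨δ', hδ', hd'⟩ := value_space_modulus (φ := φ) (u := u) hH t.2 (ε := ε / 3) (by positivity)
  refine ⟨min δ' (min δ 1), by positivity, ?_⟩
  rintro ⟨y, s⟩ hys
  rw [Prod.dist_eq, max_lt_iff, dist_eq_norm, NNReal.dist_eq] at hys
  obtain ⟨hy, hs⟩ := hys
  have hy' := hy.trans_le (min_le_left _ _)
  have hs1 := hs.trans_le ((min_le_right _ _).trans (min_le_left _ _))
  have hs2 := hs.trans_le ((min_le_right _ _).trans (min_le_right _ _))
  rw [abs_lt] at hs1 hs2
  simp only at hy' hs1 hs2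
  have h1 := hd' x y hy'
  have h2 := hd' y x (by rwa [norm_sub_rev])
  have h3 : |value H φ u i y s - value H φ u i y t| ≤ ε / 3 := by
    rcases le_total (t : ℝ) s with h | h
    · have := hd y t (s - t) t.2 (by linarith) (by linarith) (by linarith)
      rwa [add_sub_cancel] at this
    · have := hd y s (t - s) s.2 (by linarith) (by linarith) (by linarith)
      rwa [add_sub_cancel, abs_sub_comm] at this
  rw [Real.dist_eq, abs_lt]
  have h4 := abs_le.1 h3
  change value H φ u i y t ≤ value H φ u i x t + ε / 3 at h1
  change value H φ u i x t ≤ value H φ u i y t + ε / 3 at h2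
  simp only
  constructor <;> linarith

/-- The value functions of all components, as a continuous function on `𝕋^N × [0, ∞)`. -/
def valueMap (hH : ∀ i, IsAdmissible (H i)) (φ : C(Torus N, Fin m → ℝ))
    (u : C(Torus N × ℝ≥0, Fin m → ℝ)) : C(Torus N × ℝ≥0, Fin m → ℝ) where
  toFun q i := sInf (actionValues H φ u i q.1 q.2)
  continuous_toFun := by
    rw [← ((isOpenQuotientMap_proj N).prodMap IsOpenQuotientMap.id).continuous_comp_iff]
    refine continuous_pi fun i => (continuous_value (φ := φ) (u := u) (hH i)).congr fun q => ?_
    change sInf _ = sInf _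
    rw [← actionValues_proj]
    rfl

lemma valueMap_apply (hH : ∀ i, IsAdmissible (H i)) (φ : C(Torus N, Fin m → ℝ))
    (u : C(Torus N × ℝ≥0, Fin m → ℝ)) (x : E N) (t : ℝ≥0) (i : Fin m) :
    valueMap hH φ u (proj x, t) i = value H φ u i x t := by
  change sInf _ = sInf _
  rw [← actionValues_proj]

lemma isVariationalSolution_iff (hH : ∀ i, IsAdmissible (H i)) :
    IsVariationalSolution H φ u ↔
      ∀ (i : Fin m) (x : E N) (t : ℝ), 0 ≤ t → u (proj x, t.toNNReal) i = value H φ u i x t := by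
  constructor
  · intro h i x t ht
    have h1 := h i (proj x) t.toNNReal
    rw [actionValues_proj, Real.coe_toNNReal t ht] at h1
    exact h1.unique (isGLB_value (hH i) x ht)
  · intro h i x t
    obtain ⟨x, rfl⟩ := proj_surjective N x
    have h1 := h i x t t.2
    rw [Real.toNNReal_coe] at h1
    rw [actionValues_proj, h1]
    exact isGLB_value (hH i) x t.2

end Value

/-! ### Existence of a variational solution -/

section FixedPoint

open MeasureTheory BoundedContinuousFunction

variable {N m : ℕ} {H : Fin m → Torus N → E N → (Fin m → ℝ) → ℝ} {φ : C(Torus N, Fin m → ℝ)}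
  {u u' : C(Torus N × ℝ≥0, Fin m → ℝ)} {i : Fin m} {Θ : ℝ}

lemma exists_common_lipschitz (hH : ∀ i, IsAdmissible (H i)) :
    ∃ Θ : ℝ, 0 < Θ ∧ ∀ i, LipschitzInU (H i) Θ := by
  choose θ hθ0 hθ using fun i => (hH i).lipschitz
  refine ⟨∑ i, θ i + 1, by have := Finset.sum_nonneg fun i (_ : i ∈ Finset.univ) => (hθ0 i).le
                           linarith, fun i x p u v => (hθ i x p u v).trans ?_⟩
  gcongr
  have := Finset.single_le_sum (fun i _ => (hθ0 i).le) (Finset.mem_univ i)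
  linarith

/-- The exponent `2Θ` is twice the growth rate of the coupling error; it yields the factor `1/2`
used in the fixed point argument and in the a priori estimates. -/
lemma mul_integral_exp_le (hΘ : 0 < Θ) {d : ℝ} (hd : 0 ≤ d) (t : ℝ) :
    Θ * ∫ s in (0 : ℝ)..t, d * Real.exp (2 * Θ * s) ≤ d / 2 * Real.exp (2 * Θ * t) := by
  have h1 : ∫ s in (0 : ℝ)..t, Real.exp (2 * Θ * s) = (2 * Θ)⁻¹ * (Real.exp (2 * Θ * t) - 1) := by
    rw [intervalIntegral.integral_comp_mul_left (fun x => Real.exp x) (by positivity : 2 * Θ ≠ 0)]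
    simp
  rw [intervalIntegral.integral_const_mul, h1]
  have : Θ * (d * ((2 * Θ)⁻¹ * (Real.exp (2 * Θ * t) - 1))) =
      d / 2 * Real.exp (2 * Θ * t) - d / 2 := by
    field_simp
  rw [this]
  linarith

lemma abs_value_sub_le (hH : IsAdmissible (H i)) (hΘ : LipschitzInU (H i) Θ) (hΘ0 : 0 < Θ)
    (x : E N) {t : ℝ} (ht : 0 ≤ t) {d : ℝ} (hd : 0 ≤ d)
    (hu : ∀ x, ∀ s ∈ Set.Icc 0 t,
      ‖u' (x, s.toNNReal) - u (x, s.toNNReal)‖ ≤ d * Real.exp (2 * Θ * s)) :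
    |value H φ u' i x t - value H φ u i x t| ≤ d / 2 * Real.exp (2 * Θ * t) := by
  have hg : Continuous fun s => d * Real.exp (2 * Θ * s) := by fun_prop
  have h1 := value_le_of_coupling (φ := φ) hH hΘ hΘ0.le x ht hg hu
  have h2 := value_le_of_coupling (φ := φ) (u := u') (u' := u) hH hΘ hΘ0.le x ht hg
    fun x s hs => by rw [norm_sub_rev]; exact hu x s hs
  have h3 := mul_integral_exp_le hΘ0 hd t
  rw [abs_le]
  constructor <;> linarith

/-- With zero coupling the cost is independent of time, so its bounds hold for all times at once and
the growth is linear. -/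
lemma exists_value_zero_bound (hH : IsAdmissible (H i)) :
    ∃ C, 0 ≤ C ∧ ∀ (x : E N) (t : ℝ), 0 ≤ t → |value H φ 0 i x t| ≤ ‖φ‖ + C * t := by
  have hcost : ∀ x v s, cost (H i) (0 : C(Torus N × ℝ≥0, Fin m → ℝ)) x v s =
      cost (H i) 0 x v 0 := fun x v s => rfl
  obtain ⟨C, hC0, hC⟩ := hH.exists_cost_le 0 1 0
  obtain ⟨D, hD0, hD⟩ := hH.exists_cost_ge 0 le_rfl 0
  refine ⟨C + D, by positivity, fun x t ht => ?_⟩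
  have hφ : ∀ y, |φ y i| ≤ ‖φ‖ := fun y =>
    (norm_le_pi_norm (φ y) i).trans (φ.norm_coe_le_norm _)
  rw [abs_le]
  constructor
  · refine (isGLB_value hH x ht).2 ?_
    rintro _ ⟨γ, hγ, -, hinteg, rfl⟩
    have h1 := norm_sub_le_action 0 ht le_rfl hγ hinteg fun x v s _ => by
      rw [hcost]; exact hD x v 0 le_rfl
    have h2 := abs_le.1 (hφ (proj (γ 0)))
    simp only [zero_mul, sub_zero] at h1
    nlinarith
  · have h1 := value_le_move (φ := φ) (u := 0) hH (T := t) (x := x) (y := x)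
      (fun x v s hv _ => by rw [hcost]; exact hC x v 0 hv le_rfl) le_rfl ht le_rfl (by simpa using ht)
    rw [value_zero hH, sub_zero] at h1
    have h2 := abs_le.1 (hφ (proj x))
    nlinarith

/-- The coupling `e^{λ t} w(x, t)` for a bounded `w`. -/
def weighted (l : ℝ) (w : Torus N × ℝ≥0 →ᵇ (Fin m → ℝ)) : C(Torus N × ℝ≥0, Fin m → ℝ) where
  toFun q := Real.exp (l * q.2) • w q
  continuous_toFun := by fun_prop

lemma norm_weighted_sub_le (l : ℝ) (w w' : Torus N × ℝ≥0 →ᵇ (Fin m → ℝ)) (x : Torus N) {s : ℝ}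
    (hs : 0 ≤ s) :
    ‖weighted l w (x, s.toNNReal) - weighted l w' (x, s.toNNReal)‖ ≤ ‖w - w'‖ * Real.exp (l * s) := by
  change ‖Real.exp (l * s.toNNReal) • w (x, s.toNNReal) -
    Real.exp (l * s.toNNReal) • w' (x, s.toNNReal)‖ ≤ _
  rw [← smul_sub, norm_smul, Real.coe_toNNReal s hs, Real.norm_of_nonneg (Real.exp_nonneg _),
    mul_comm]
  gcongr
  exact (w - w').norm_coe_le_norm _

/-- The weighted fixed point map takes bounded functions to bounded functions: compare with zero
coupling, whose linear growth the exponential weight dominates. -/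
lemma exists_bound_valueMap (hH : ∀ i, IsAdmissible (H i)) (hΘ : ∀ i, LipschitzInU (H i) Θ)
    (hΘ0 : 0 < Θ) (φ : C(Torus N, Fin m → ℝ)) (w : Torus N × ℝ≥0 →ᵇ (Fin m → ℝ)) :
    ∃ B, ∀ q : Torus N × ℝ≥0,
      ‖Real.exp (-(2 * Θ * q.2)) • valueMap hH φ (weighted (2 * Θ) w) q‖ ≤ B := by
  choose C hC0 hC using fun i => exists_value_zero_bound (φ := φ) (hH i)
  have hS0 : 0 ≤ ∑ i, C i := Finset.sum_nonneg fun i _ => hC0 i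
  refine ⟨‖w‖ / 2 + ‖φ‖ + (∑ i, C i) / (2 * Θ), ?_⟩
  rintro ⟨x, t⟩
  obtain ⟨x, rfl⟩ := proj_surjective N x
  rw [pi_norm_le_iff_of_nonneg (by positivity)]
  intro i
  simp only [Pi.smul_apply, smul_eq_mul, valueMap_apply, norm_mul, Real.norm_eq_abs,
    abs_of_pos (Real.exp_pos _)]
  have h1 : |value H φ (weighted (2 * Θ) w) i x t - value H φ 0 i x t| ≤
      ‖w‖ / 2 * Real.exp (2 * Θ * t) := by
    refine abs_value_sub_le (hH i) (hΘ i) hΘ0 x t.2 (norm_nonneg w) fun x s hs => ?_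
    have := norm_weighted_sub_le (2 * Θ) w 0 x hs.1
    have h0 : weighted (2 * Θ) (0 : Torus N × ℝ≥0 →ᵇ (Fin m → ℝ)) = 0 := by
      ext; simp [weighted]
    rw [h0, sub_zero w] at this
    exact this
  have h2 := hC i x t t.2
  have h3 : |value H φ (weighted (2 * Θ) w) i x t| ≤
      ‖w‖ / 2 * Real.exp (2 * Θ * t) + (‖φ‖ + C i * t) := by
    have := abs_sub_abs_le_abs_sub (value H φ (weighted (2 * Θ) w) i x t) (value H φ 0 i x t)
    linarith
  have h4 : C i ≤ ∑ i, C i := Finset.single_le_sum (fun i _ => hC0 i) (Finset.mem_univ i)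
  have h5 : 1 ≤ Real.exp (2 * Θ * t) := Real.one_le_exp (by positivity)
  have h6 : 2 * Θ * t ≤ Real.exp (2 * Θ * t) := by
    linarith [Real.add_one_le_exp (2 * Θ * t)]
  rw [Real.exp_neg, inv_mul_le_iff₀ (Real.exp_pos _)]
  have h7 : C i * t ≤ (∑ i, C i) / (2 * Θ) * Real.exp (2 * Θ * t) := by
    calc C i * t ≤ (∑ i, C i) * t := by gcongr
      _ = (∑ i, C i) / (2 * Θ) * (2 * Θ * t) := by field_simp
      _ ≤ _ := by gcongr
  have h8 : ‖φ‖ ≤ ‖φ‖ * Real.exp (2 * Θ * t) := le_mul_of_one_le_right (norm_nonneg _) h5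
  linarith

/-- Writing the coupling as `e^{2Θt} w` with `w` bounded turns the weighted norm into the usual sup
norm on a complete space, where the conjugated map contracts by `1/2` on all of `[0, ∞)` at once. -/
theorem exists_isVariationalSolution (hH : ∀ i, IsAdmissible (H i))
    (φ : C(Torus N, Fin m → ℝ)) : ∃ u, IsVariationalSolution H φ u := by
  obtain ⟨Θ, hΘ0, hΘ⟩ := exists_common_lipschitz hH
  choose B hB using exists_bound_valueMap hH hΘ hΘ0 φ
  let F : (Torus N × ℝ≥0 →ᵇ (Fin m → ℝ)) → (Torus N × ℝ≥0 →ᵇ (Fin m → ℝ)) := fun w =>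
    BoundedContinuousFunction.ofNormedAddCommGroup
      (fun q => Real.exp (-(2 * Θ * q.2)) • valueMap hH φ (weighted (2 * Θ) w) q)
      (by fun_prop) (B w) (hB w)
  have hF : ContractingWith (1 / 2 : ℝ≥0) F := by
    refine ⟨by norm_num, LipschitzWith.of_dist_le_mul fun w w' => ?_⟩
    rw [BoundedContinuousFunction.dist_le (by positivity)]
    rintro ⟨x, t⟩
    obtain ⟨x, rfl⟩ := proj_surjective N x
    rw [dist_pi_le_iff (by positivity)]
    intro i
    have h1 := abs_value_sub_le (φ := φ) (hH i) (hΘ i) hΘ0 x t.coe_nonneg (norm_nonneg (w - w'))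
      fun x s hs => norm_weighted_sub_le (2 * Θ) w w' x hs.1
    change dist (Real.exp (-(2 * Θ * t)) * valueMap hH φ (weighted (2 * Θ) w) (proj x, t) i)
      (Real.exp (-(2 * Θ * t)) * valueMap hH φ (weighted (2 * Θ) w') (proj x, t) i) ≤ _
    rw [valueMap_apply, valueMap_apply, Real.dist_eq, ← mul_sub, abs_mul,
      abs_of_pos (Real.exp_pos _), Real.exp_neg, inv_mul_le_iff₀ (Real.exp_pos _), dist_eq_norm]
    refine h1.trans (le_of_eq ?_)
    have h2 : ((1 / 2 : ℝ≥0) : ℝ) = 1 / 2 := by simp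
    rw [h2]
    ring
  obtain ⟨w, hw, -⟩ := hF.exists_fixedPoint 0 (edist_ne_top _ _)
  refine ⟨weighted (2 * Θ) w, (isVariationalSolution_iff hH).2 fun i x t ht => ?_⟩
  lift t to ℝ≥0 using ht
  rw [Real.toNNReal_coe, ← valueMap_apply hH]
  have h1 : w (proj x, t) = Real.exp (-(2 * Θ * t)) • valueMap hH φ (weighted (2 * Θ) w) (proj x, t) :=
    congrArg (fun f => f (proj x, t)) hw.symm
  change (Real.exp (2 * Θ * t) • w (proj x, t)) i = _
  rw [h1, smul_smul, ← Real.exp_add, add_neg_cancel, Real.exp_zero, one_smul]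

end FixedPoint

/-! ### Variational solutions are viscosity solutions -/

section Viscosity

open MeasureTheory

variable {N m : ℕ} {H : Fin m → Torus N → E N → (Fin m → ℝ) → ℝ} {φ : C(Torus N, Fin m → ℝ)}
  {u : C(Torus N × ℝ≥0, Fin m → ℝ)} {i : Fin m}

lemma fderiv_apply_prod {ψ : E N × ℝ → ℝ} {x : E N} {t : ℝ} (hψ : DifferentiableAt ℝ ψ (x, t))
    (v : E N) (r : ℝ) :
    fderiv ℝ ψ (x, t) (v, r) =
      inner ℝ (gradient (fun y => ψ (y, t)) x) v + r * deriv (fun s => ψ (x, s)) t := by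
  have h1 : HasFDerivAt (fun y => ψ (y, t))
      ((fderiv ℝ ψ (x, t)).comp (ContinuousLinearMap.inl ℝ (E N) ℝ)) x :=
    hψ.hasFDerivAt.comp x (hasFDerivAt_prodMk_left x t)
  have h2 : HasDerivAt (fun s => ψ (x, s)) (fderiv ℝ ψ (x, t) (0, 1)) t :=
    hψ.hasFDerivAt.comp_hasDerivAt t ((hasDerivAt_const t x).prodMk (hasDerivAt_id t))
  rw [inner_gradient_left, h1.fderiv, h2.deriv]
  have : ((v, r) : E N × ℝ) = (v, 0) + r • ((0 : E N), (1 : ℝ)) := by simp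
  rw [this, map_add, map_smul]
  rfl

lemma deriv_nonneg_of_eventually_le {f : ℝ → ℝ} {f' t : ℝ} (hf : HasDerivAt f f' t)
    (h : ∀ᶠ s in nhdsWithin t (Set.Iio t), f s ≤ f t) : 0 ≤ f' := by
  have h1 : Filter.Tendsto (slope f t) (nhdsWithin t (Set.Iio t)) (nhds f') :=
    (hasDerivWithinAt_iff_tendsto_slope' (by simp)).1 (hf.hasDerivWithinAt (s := Set.Iio t))
  refine ge_of_tendsto h1 ?_
  filter_upwards [h, self_mem_nhdsWithin] with s hs hst
  rw [slope_def_field]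
  exact div_nonneg_of_nonpos (by linarith) (by have : s < t := hst; linarith)

/-- Reach `(x, t)` from the past along the line with the velocity `v` that is optimal for the
gradient of `ψ`. The maximum property and `value_le_segment` bound the action minus `ψ` on the left
of `t` by its value at `t`. Its derivative there is thus nonnegative, which gives `∂ₜψ + ⟨p, v⟩ ≤ L
= ⟨p, v⟩ - H` for `p = ∂ₓψ`. -/
lemma subsolution_test (hH : IsAdmissible (H i))
    (hu : ∀ (x : E N) (t : ℝ), 0 ≤ t → u (proj x, t.toNNReal) i = value H φ u i x t)
    {x : E N} {t : ℝ} (ht : 0 < t) {ψ : E N × ℝ → ℝ} (hψ : ContDiffAt ℝ 1 ψ (x, t))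
    (hmax : IsLocalMax (fun q : E N × ℝ => u (proj q.1, q.2.toNNReal) i - ψ q) (x, t)) :
    deriv (fun s => ψ (x, s)) t
      + H i (proj x) (gradient (fun y => ψ (y, t)) x) (u (proj x, t.toNNReal)) ≤ 0 := by
  have hd : DifferentiableAt ℝ ψ (x, t) := hψ.differentiableAt (by norm_num)
  obtain ⟨v, hv⟩ := hH.exists_lagrangian_le (proj x) (gradient (fun y => ψ (y, t)) x)
    (u (proj x, t.toNNReal))
  set c : ℝ → ℝ := fun r => cost (H i) u (x + (r - t) • v) v r with hcdef
  have hc : Continuous c :=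
    (hH.continuous_cost u).comp (f := fun r : ℝ => (x + (r - t) • v, v, r)) (by fun_prop)
  have hG : HasDerivAt (fun τ => ∫ r in t..τ, c r) (c t) t :=
    intervalIntegral.integral_hasDerivAt_right (hc.intervalIntegrable t t)
      (hc.stronglyMeasurableAtFilter _ _) hc.continuousAt
  have hline : HasDerivAt (fun τ : ℝ => (x + (τ - t) • v, τ)) (v, (1 : ℝ)) t := by
    refine HasDerivAt.prodMk ?_ (hasDerivAt_id t)
    simpa using (((hasDerivAt_id t).sub_const t).smul_const v).const_add x
  have hline0 : (fun τ : ℝ => (x + (τ - t) • v, τ)) t = (x, t) := by simp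
  have hΨ : HasDerivAt (fun τ : ℝ => ψ (x + (τ - t) • v, τ)) (fderiv ℝ ψ (x, t) (v, 1)) t := by
    have h1 : HasFDerivAt ψ (fderiv ℝ ψ (x, t)) ((fun τ : ℝ => (x + (τ - t) • v, τ)) t) := by
      rw [hline0]; exact hd.hasFDerivAt
    exact h1.comp_hasDerivAt (f := fun τ : ℝ => (x + (τ - t) • v, τ)) t hline
  have hev : ∀ᶠ τ in nhds t, u (proj (x + (τ - t) • v), τ.toNNReal) i - ψ (x + (τ - t) • v, τ) ≤
      u (proj x, t.toNNReal) i - ψ (x, t) := by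
    have h1 : Filter.Tendsto (fun τ : ℝ => (x + (τ - t) • v, τ)) (nhds t) (nhds (x, t)) := by
      have := hline.continuousAt.tendsto
      simpa using this
    exact h1.eventually hmax
  have key := deriv_nonneg_of_eventually_le (hG.sub hΨ) (by
    filter_upwards [nhdsWithin_le_nhds hev, nhdsWithin_le_nhds (Ioi_mem_nhds ht),
      self_mem_nhdsWithin] with τ h1 h2 h3
    have h2' : 0 ≤ τ := le_of_lt h2
    have h3' : τ ≤ t := le_of_lt h3
    have h4 := value_le_segment (φ := φ) (u := u) hH (x + (τ - t) • v) v h2' h3'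
    rw [add_assoc, ← add_smul, sub_add_sub_cancel, sub_self, zero_smul, add_zero,
      ← hu x t ht.le, ← hu _ τ h2'] at h4
    have h5 : ∫ r in τ..t, cost (H i) u (x + (τ - t) • v + (r - τ) • v) v r = ∫ r in τ..t, c r := by
      refine intervalIntegral.integral_congr fun r _ => ?_
      simp only [hcdef]
      rw [add_assoc, ← add_smul]
      congr 3
      ring
    rw [h5, intervalIntegral.integral_symm] at h4
    simp only [Pi.sub_apply, sub_self, zero_smul, add_zero, intervalIntegral.integral_same]
    linarith)
  rw [fderiv_apply_prod hd] at key
  have h1 : c t = lagrangian (H i) (proj x) v (u (proj x, t.toNNReal)) := by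
    simp [hcdef, cost]
  rw [h1] at key
  linarith

/-- The strict inequality persists nearby by continuity, and the Fenchel inequality turns it into a
bound valid for all velocities simultaneously. That uniformity is needed because velocities of
competitors are unbounded. -/
lemma exists_strict_neighborhood (hH : IsAdmissible (H i)) {x : E N} {t : ℝ}
    {ψ : E N × ℝ → ℝ} (hψ : ContDiffAt ℝ 1 ψ (x, t))
    (hneg : deriv (fun s => ψ (x, s)) t
      + H i (proj x) (gradient (fun y => ψ (y, t)) x) (u (proj x, t.toNNReal)) < 0) :
    ∃ δ > 0, ∀ᶠ q : E N × ℝ in nhds (x, t), DifferentiableAt ℝ ψ q ∧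
      ∀ v : E N, fderiv ℝ ψ q (v, 1) ≤ cost (H i) u q.1 v q.2 - δ := by
  have hcd : ContinuousAt (fderiv ℝ ψ) (x, t) :=
    (hψ.fderiv_right (m := 0) (by norm_num)).continuousAt
  set P : E N × ℝ → E N := fun q => (InnerProductSpace.toDual ℝ (E N)).symm
    ((fderiv ℝ ψ q).comp (ContinuousLinearMap.inl ℝ (E N) ℝ)) with hP
  have hPc : ContinuousAt P (x, t) := by
    refine (InnerProductSpace.toDual ℝ (E N)).symm.continuous.continuousAt.comp ?_
    exact (ContinuousLinearMap.compL ℝ (E N) (E N × ℝ) ℝ).flip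
      (ContinuousLinearMap.inl ℝ (E N) ℝ) |>.continuous.continuousAt.comp hcd
  have hP1 : ∀ q v, inner ℝ (P q) v = fderiv ℝ ψ q (v, 0) := fun q v => by
    simp [hP]
  have hac : ContinuousAt (fun q => fderiv ℝ ψ q (0, 1)) (x, t) :=
    (ContinuousLinearMap.apply ℝ ℝ ((0 : E N), (1 : ℝ))).continuous.continuousAt.comp hcd
  have hFc : ContinuousAt (fun q : E N × ℝ => fderiv ℝ ψ q (0, 1) +
      H i (proj q.1) (P q) (u (proj q.1, q.2.toNNReal))) (x, t) := by
    refine hac.add ?_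
    refine hH.continuous.continuousAt.comp
      (f := fun q : E N × ℝ => (proj q.1, P q, u (proj q.1, q.2.toNNReal))) ?_
    exact ((continuous_proj N).comp continuous_fst).continuousAt.prodMk
      (hPc.prodMk (continuous_lift u).continuousAt)
  have hd : DifferentiableAt ℝ ψ (x, t) := hψ.differentiableAt (by norm_num)
  have hPx : P (x, t) = gradient (fun y => ψ (y, t)) x := by
    refine ext_inner_right ℝ fun v => ?_
    rw [hP1, fderiv_apply_prod hd]; simp
  have hax : fderiv ℝ ψ (x, t) (0, 1) = deriv (fun s => ψ (x, s)) t := by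
    rw [fderiv_apply_prod hd]; simp
  set b := deriv (fun s => ψ (x, s)) t
      + H i (proj x) (gradient (fun y => ψ (y, t)) x) (u (proj x, t.toNNReal)) with hb
  refine ⟨-b / 2, by linarith, ?_⟩
  have hbneg : fderiv ℝ ψ (x, t) (0, 1) +
      H i (proj x) (P (x, t)) (u (proj x, t.toNNReal)) < b / 2 := by
    rw [hPx, hax, ← hb]; linarith
  have h1 := hFc.eventually (gt_mem_nhds hbneg)
  have h2 : ∀ᶠ q in nhds (x, t), DifferentiableAt ℝ ψ q :=
    (hψ.eventually (by norm_num)).mono fun q hq => hq.differentiableAt (by norm_num)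
  filter_upwards [h1, h2] with q hq1 hq2
  refine ⟨hq2, fun v => ?_⟩
  have h3 := hH.inner_sub_le (proj q.1) v (P q) (u (proj q.1, q.2.toNNReal))
  rw [hP1] at h3
  have h4 : fderiv ℝ ψ q (v, 1) = fderiv ℝ ψ q (v, 0) + fderiv ℝ ψ q (0, 1) := by
    rw [← map_add]; simp
  unfold cost
  linarith

/-- If the inequality failed, `ψ` would grow along every curve near `(x, t)` more slowly than the
action, by a rate `δ`. Along a curve optimal up to `δ * h / 2` over a final interval of length `h`,
the loss `δ * h` contradicts the minimum. -/
lemma supersolution_test (hH : IsAdmissible (H i))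
    (hu : ∀ (x : E N) (t : ℝ), 0 ≤ t → u (proj x, t.toNNReal) i = value H φ u i x t)
    {x : E N} {t : ℝ} (ht : 0 < t) {ψ : E N × ℝ → ℝ} (hψ : ContDiffAt ℝ 1 ψ (x, t))
    (hmin : IsLocalMin (fun q : E N × ℝ => u (proj q.1, q.2.toNNReal) i - ψ q) (x, t)) :
    0 ≤ deriv (fun s => ψ (x, s)) t
      + H i (proj x) (gradient (fun y => ψ (y, t)) x) (u (proj x, t.toNNReal)) := by
  by_contra! hneg
  obtain ⟨δ, hδ, hstrict⟩ := exists_strict_neighborhood hH hψ hneg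
  obtain ⟨K, S, hS, hLip⟩ := hψ.exists_lipschitzOnWith
  obtain ⟨r, hr, hball⟩ := Metric.eventually_nhds_iff.1
    (hstrict.and ((Filter.eventually_mem_set.2 hS).and hmin))
  obtain ⟨B, hB0, hB⟩ := exists_bound_le_time u t
  have hBi : ∀ y s, s ≤ t → |u (y, s.toNNReal) i| ≤ B := fun y s hs =>
    (norm_le_pi_norm _ i).trans (hB y s hs)
  -- The final action is at most `2B + 1` and `C * h ≤ 1`, so this slope confines the curve to
  -- distance `r / 2` of `x` during `[t - h, t]`.
  set A : ℝ := (2 * B + 2) * 2 / r with hA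
  have hA0 : 0 < A := by positivity
  obtain ⟨C, hC0, hC⟩ := hH.exists_cost_ge u hA0.le t
  set h : ℝ := min (min (r / 2) t) (1 / (C + 1)) with hh
  have hh0 : 0 < h := by positivity
  have hhr : h ≤ r / 2 := (min_le_left _ _).trans (min_le_left _ _)
  have hht : h ≤ t := (min_le_left _ _).trans (min_le_right _ _)
  have hhC : C * h ≤ 1 := by
    have : h ≤ 1 / (C + 1) := min_le_right _ _
    rw [le_div_iff₀ (by positivity)] at this
    linarith
  obtain ⟨γ, hγ, hγt, hinteg, hopt⟩ := exists_near_optimal (φ := φ) (u := u) hH x ht.le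
    (ε := min 1 (δ * h / 2)) (by positivity)
  have hsub : ∀ s ∈ Set.Icc 0 t, Set.uIcc 0 s ⊆ Set.uIcc 0 t ∧ Set.uIcc s t ⊆ Set.uIcc 0 t := by
    intro s hs
    rw [Set.uIcc_of_le hs.1, Set.uIcc_of_le hs.2, Set.uIcc_of_le ht.le]
    exact ⟨Set.Icc_subset_Icc_right hs.2, Set.Icc_subset_Icc_left hs.1⟩
  have hact : ∀ s ∈ Set.Icc 0 t, ∫ τ in s..t, lagrangianAlong (H i) u γ τ ≤
      u (proj x, t.toNNReal) i - u (proj (γ s), s.toNNReal) i + min 1 (δ * h / 2) := by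
    intro s hs
    obtain ⟨h1, h2⟩ := hsub s hs
    have h3 := value_le_of_curve (φ := φ) hH hs.1 (hγ.mono h1) (hinteg.mono_set h1)
    have h4 := intervalIntegral.integral_add_adjacent_intervals (hinteg.mono_set h1)
      (hinteg.mono_set h2)
    rw [hu x t ht.le, hu (γ s) s hs.1]
    linarith
  have hnear : ∀ s ∈ Set.Icc (t - h) t, dist (γ s, s) (x, t) < r := by
    intro s hs
    have hs' : s ∈ Set.Icc 0 t := ⟨by linarith [hs.1], hs.2⟩
    obtain ⟨-, h2⟩ := hsub s hs'
    have h3 := norm_sub_le_action u hs.2 hA0.le (hγ.mono h2) (hinteg.mono_set h2) hC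
    have h4 := hact s hs'
    have h5 := abs_le.1 (hBi (proj x) t le_rfl)
    have h6 := abs_le.1 (hBi (proj (γ s)) s hs.2)
    have h7 : C * (t - s) ≤ C * h := by gcongr; linarith [hs.1]
    have h8 : A * ‖γ t - γ s‖ ≤ 2 * B + 2 := by linarith [min_le_left 1 (δ * h / 2)]
    have h9 : ‖γ t - γ s‖ ≤ r / 2 := by
      have : A * (r / 2) = 2 * B + 2 := by rw [hA]; field_simp
      rw [← this] at h8
      exact le_of_mul_le_mul_left h8 hA0
    rw [Prod.dist_eq, max_lt_iff]
    constructor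
    · rw [dist_comm, dist_eq_norm, ← hγt]; linarith
    · rw [Real.dist_eq, abs_lt]; constructor <;> linarith [hs.1, hs.2]
  have hth : t - h ∈ Set.Icc 0 t := ⟨by linarith, by linarith⟩
  have hle : t - h ≤ t := hth.2
  obtain ⟨-, hsub2⟩ := hsub (t - h) hth
  have hγ2 := hγ.mono hsub2
  have hinteg2 := hinteg.mono_set hsub2
  have hac : AbsolutelyContinuousOnInterval (fun s => ψ (γ s, s)) (t - h) t := by
    refine absolutelyContinuousOnInterval_of_dist_le (K := K) hγ2 fun s hs τ hτ => ?_
    rw [Set.uIcc_of_le hle] at hs hτ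
    refine (hLip.dist_le_mul _ (hball (hnear s hs)).2.1 _ (hball (hnear τ hτ)).2.1).trans ?_
    gcongr
    rw [Prod.dist_eq]
    exact max_le_add_of_nonneg dist_nonneg dist_nonneg
  have hdiff := hγ2.boundedVariationOn.ae_differentiableAt_of_mem_uIcc
  have hmain := absolutelyContinuousOnInterval_sub_le hle hac
    (hinteg2.sub (intervalIntegrable_const (c := δ))) (by
      filter_upwards [hdiff] with s hs hs'
      have hsI : s ∈ Set.Icc (t - h) t := ⟨hs'.1.le, hs'.2.le⟩
      have hd := (hs (by rwa [Set.uIcc_of_le hle])).hasDerivAt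
      obtain ⟨⟨hq1, hq2⟩, -⟩ := hball (hnear s hsI)
      have h2 : HasDerivAt (fun s => ψ (γ s, s)) (fderiv ℝ ψ (γ s, s) (deriv γ s, 1)) s :=
        hq1.hasFDerivAt.comp_hasDerivAt (f := fun s => (γ s, s)) s (hd.prodMk (hasDerivAt_id s))
      rw [h2.deriv]
      exact hq2 (deriv γ s))
  rw [intervalIntegral.integral_sub hinteg2 intervalIntegrable_const,
    intervalIntegral.integral_const, smul_eq_mul, sub_sub_cancel] at hmain
  have h1 := hact (t - h) hth
  have h2 := (hball (hnear (t - h) ⟨le_rfl, hle⟩)).2.2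
  simp only [hγt] at hmain h2
  have h3 := min_le_right 1 (δ * h / 2)
  have h4 : 0 < δ * h := by positivity
  linarith

theorem IsVariationalSolution.isViscositySolution (hH : ∀ i, IsAdmissible (H i))
    (h : IsVariationalSolution H φ u) : IsViscositySolution H φ u := by
  have hu := (isVariationalSolution_iff hH).1 h
  have h0 : ∀ i x, u (x, 0) i = φ x i := fun i x => by
    obtain ⟨x, rfl⟩ := proj_surjective N x
    have := hu i x 0 le_rfl
    rwa [Real.toNNReal_zero, value_zero (hH i)] at this
  exact ⟨fun i => ⟨fun x => (h0 i x).le, fun x t ht ψ hψ hmax =>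
      subsolution_test (hH i) (hu i) ht hψ hmax⟩,
    fun i => ⟨fun x => (h0 i x).ge, fun x t ht ψ hψ hmin =>
      supersolution_test (hH i) (hu i) ht hψ hmin⟩⟩

end Viscosity

/-! ### Lipschitz regularity for Lipschitz data -/

section Lipschitz

open MeasureTheory

variable {N m : ℕ} {H : Fin m → Torus N → E N → (Fin m → ℝ) → ℝ} {φ : C(Torus N, Fin m → ℝ)}
  {u : C(Torus N × ℝ≥0, Fin m → ℝ)} {K : ℝ}

/-- A self-improving estimate: the largest weighted time increment `d`, attained by compactness,
enters the bound from `value_le_shift` through the coupling with factor `1/2`, so `d ≤ S * r + d /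
2`. For a Lipschitz datum the error `κ` is zero. -/
lemma IsVariationalSolution.exists_lipschitz_time (hH : ∀ i, IsAdmissible (H i))
    (h : IsVariationalSolution H φ u) (hK : 0 ≤ K)
    (hφ : ∀ (x y : E N) i, φ (proj x) i - φ (proj y) i ≤ K * ‖x - y‖) (T : ℝ) :
    ∃ M, 0 ≤ M ∧ ∀ x t r, 0 ≤ t → 0 ≤ r → t + r ≤ T →
      ‖u (x, t.toNNReal) - u (x, (t + r).toNNReal)‖ ≤ M * r := by
  have hu := (isVariationalSolution_iff hH).1 h
  obtain ⟨Θ, hΘ0, hΘ⟩ := exists_common_lipschitz hH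
  choose C hC0 hC using fun i => (hH i).exists_cost_ge u hK T
  choose D hD0 hD using fun i => (hH i).exists_cost_le u 1 T
  set S : ℝ := ∑ i, (C i + D i) with hS
  have hS0 : 0 ≤ S := Finset.sum_nonneg fun i _ => add_nonneg (hC0 i) (hD0 i)
  have hSi : ∀ i, C i + D i ≤ S := fun i =>
    Finset.single_le_sum (f := fun i => C i + D i) (fun i _ => add_nonneg (hC0 i) (hD0 i))
      (Finset.mem_univ i)
  refine ⟨2 * S * Real.exp (2 * Θ * T), by positivity, fun x t r ht hr htr => ?_⟩
  have hcont : Continuous fun q : Torus N × ℝ => Real.exp (-(2 * Θ * q.2)) *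
      ‖u (q.1, q.2.toNNReal) - u (q.1, (q.2 + r).toNNReal)‖ := by
    have h1 : Continuous fun q : Torus N × ℝ => u (q.1, q.2.toNNReal) :=
      u.continuous.comp (continuous_fst.prodMk (continuous_real_toNNReal.comp continuous_snd))
    have h2 : Continuous fun q : Torus N × ℝ => u (q.1, (q.2 + r).toNNReal) :=
      u.continuous.comp (continuous_fst.prodMk
        (continuous_real_toNNReal.comp (continuous_snd.add continuous_const)))
    exact (by fun_prop : Continuous fun q : Torus N × ℝ => Real.exp (-(2 * Θ * q.2))).mul
      (h1.sub h2).norm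
  obtain ⟨⟨x₀, t₀⟩, ⟨-, ht₀⟩, hmax⟩ :=
    ((isCompact_univ (X := Torus N)).prod (isCompact_Icc (a := 0) (b := T - r))).exists_isMaxOn
    ⟨(x, t), trivial, ht, by simp only; linarith⟩ hcont.continuousOn
  set d : ℝ := Real.exp (-(2 * Θ * t₀)) *
    ‖u (x₀, t₀.toNNReal) - u (x₀, (t₀ + r).toNNReal)‖ with hd
  have hd0 : 0 ≤ d := by positivity
  have hbd : ∀ y, ∀ s ∈ Set.Icc 0 (T - r),
      ‖u (y, s.toNNReal) - u (y, (s + r).toNNReal)‖ ≤ d * Real.exp (2 * Θ * s) := by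
    intro y s hs
    have h1 : Real.exp (-(2 * Θ * s)) * ‖u (y, s.toNNReal) - u (y, (s + r).toNNReal)‖ ≤ d :=
      hmax (⟨trivial, hs⟩ : (y, s) ∈ Set.univ ×ˢ Set.Icc 0 (T - r))
    rwa [Real.exp_neg, inv_mul_le_iff₀ (Real.exp_pos _), mul_comm] at h1
  have hest : ∀ y, ∀ s ∈ Set.Icc 0 (T - r),
      ‖u (y, s.toNNReal) - u (y, (s + r).toNNReal)‖ ≤ S * r + d / 2 * Real.exp (2 * Θ * s) := by
    intro y s hs
    obtain ⟨y, rfl⟩ := proj_surjective N y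
    have hsr : s + r ≤ T := by linarith [hs.2]
    refine (pi_norm_le_iff_of_nonneg (by positivity)).2 fun i => ?_
    have h1 := value_le_move (φ := φ) (hH i) (hD i) (x := y) (y := y) hs.1
      (by linarith : s ≤ s + r) hsr (by simpa using hr)
    have h2 := value_le_shift (φ := φ) (κ := 0) (hH i) (hΘ i) hΘ0.le y hs.1 hr hK
      (fun x y => by simpa using hφ x y i) (fun x v τ hτ => hC i x v τ (hτ.trans hsr))
      (by fun_prop : Continuous fun s => d * Real.exp (2 * Θ * s))
      (fun x τ hτ => hbd x τ ⟨hτ.1, hτ.2.trans hs.2⟩)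
    have h3 := mul_integral_exp_le hΘ0 hd0 s
    rw [Pi.sub_apply, Real.norm_eq_abs, hu i y s hs.1, hu i y (s + r) (by linarith [hs.1]), abs_le]
    rw [add_sub_cancel_left] at h1
    have h4 : (C i + D i) * r ≤ S * r := by gcongr; exact hSi i
    have h5 : 0 ≤ C i * r := mul_nonneg (hC0 i) hr
    have h6 : 0 ≤ D i * r := mul_nonneg (hD0 i) hr
    have h7 : 0 ≤ d / 2 * Real.exp (2 * Θ * s) := by positivity
    constructor <;> linarith
  have hd2 : d ≤ 2 * (S * r) := by
    have h1 := hest x₀ t₀ ht₀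
    have h2 : Real.exp (-(2 * Θ * t₀)) ≤ 1 :=
      Real.exp_le_one_iff.2 (by have := ht₀.1; simp only [Left.neg_nonpos_iff]; positivity)
    have h3 : d ≤ Real.exp (-(2 * Θ * t₀)) * (S * r + d / 2 * Real.exp (2 * Θ * t₀)) := by
      rw [hd]; gcongr
    have h4 : Real.exp (-(2 * Θ * t₀)) * (d / 2 * Real.exp (2 * Θ * t₀)) = d / 2 := by
      rw [Real.exp_neg]; field_simp
    have h5 : Real.exp (-(2 * Θ * t₀)) * (S * r) ≤ 1 * (S * r) := by gcongr
    linarith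
  refine (hbd x t ⟨ht, by linarith⟩).trans ?_
  have h1 : Real.exp (2 * Θ * t) ≤ Real.exp (2 * Θ * T) := by
    gcongr; linarith
  calc d * Real.exp (2 * Θ * t) ≤ 2 * (S * r) * Real.exp (2 * Θ * T) := by gcongr
    _ = _ := by ring

/-- If `‖y - x‖ ≤ t`, move at unit speed from an earlier time and use the time estimate. Otherwise
`t` itself is at most `‖y - x‖`, and one passes through the datum at time zero. -/
lemma IsVariationalSolution.exists_lipschitz_space (hH : ∀ i, IsAdmissible (H i))
    (h : IsVariationalSolution H φ u) (hK : 0 ≤ K)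
    (hφ : ∀ (x y : E N) i, φ (proj x) i - φ (proj y) i ≤ K * ‖x - y‖) (T : ℝ) :
    ∃ M, 0 ≤ M ∧ ∀ i (x y : E N) t, 0 ≤ t → t ≤ T →
      u (proj y, t.toNNReal) i - u (proj x, t.toNNReal) i ≤ M * ‖y - x‖ := by
  obtain ⟨M, hM0, hM⟩ := h.exists_lipschitz_time hH hK hφ T
  have hu := (isVariationalSolution_iff hH).1 h
  choose D hD0 hD using fun i => (hH i).exists_cost_le u 1 T
  have hS0 : 0 ≤ ∑ i, D i := Finset.sum_nonneg fun i _ => hD0 i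
  refine ⟨2 * M + K + ∑ i, D i, by positivity, fun i x y t ht htT => ?_⟩
  have hSi : D i ≤ ∑ i, D i := Finset.single_le_sum (fun i _ => hD0 i) (Finset.mem_univ i)
  have hMi : ∀ z s r, 0 ≤ s → 0 ≤ r → s + r ≤ T →
      |u (z, s.toNNReal) i - u (z, (s + r).toNNReal) i| ≤ M * r := fun z s r hs hr hsr =>
    (norm_le_pi_norm (u (z, s.toNNReal) - u (z, (s + r).toNNReal)) i).trans (hM z s r hs hr hsr)
  have hn := norm_nonneg (y - x)
  have h0 : D i * ‖y - x‖ ≤ (∑ i, D i) * ‖y - x‖ := by gcongr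
  have hDn : 0 ≤ D i * ‖y - x‖ := mul_nonneg (hD0 i) hn
  have hMn : 0 ≤ M * ‖y - x‖ := mul_nonneg hM0 hn
  have hKn : 0 ≤ K * ‖y - x‖ := mul_nonneg hK hn
  rcases le_total ‖y - x‖ t with hle | hle
  · have h1 := value_le_move (φ := φ) (hH i) (hD i) (x := x) (y := y) (s := t - ‖y - x‖) (t := t)
      (by linarith) (by linarith) htT (by simp)
    have h2 := abs_le.1 (hMi (proj x) (t - ‖y - x‖) ‖y - x‖ (by linarith) hn (by simpa using htT))
    rw [sub_add_cancel] at h2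
    rw [sub_sub_cancel, ← hu i y t ht, ← hu i x (t - ‖y - x‖) (by linarith)] at h1
    linarith [h2.2]
  · have h1 := abs_le.1 (hMi (proj x) 0 t le_rfl ht (by simpa using htT))
    have h2 := abs_le.1 (hMi (proj y) 0 t le_rfl ht (by simpa using htT))
    rw [zero_add, hu i x 0 le_rfl, value_zero (hH i)] at h1
    rw [zero_add, hu i y 0 le_rfl, value_zero (hH i)] at h2
    have h3 := hφ y x i
    have h4 : M * t ≤ M * ‖y - x‖ := by gcongr
    linarith [h1.2, h2.1]

end Lipschitz

/-! ### Comparison by doubling of variables -/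

section Comparison

open Filter Topology

variable {N : ℕ}

/-- `w` is a viscosity subsolution of `∂ₜ w + F(x, t, ∂ₓ w) = 0` on `ℝ^N × (0, T)`. -/
def IsSubsolutionOn (F : E N × ℝ × E N → ℝ) (T : ℝ) (w : E N × ℝ → ℝ) : Prop :=
  ∀ (x : E N) (t : ℝ), 0 < t → t < T → ∀ ψ : E N × ℝ → ℝ, ContDiffAt ℝ 1 ψ (x, t) →
    IsLocalMax (fun q => w q - ψ q) (x, t) →
    deriv (fun s => ψ (x, s)) t + F (x, t, gradient (fun y => ψ (y, t)) x) ≤ 0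

/-- `w` is a viscosity supersolution of `∂ₜ w + F(x, t, ∂ₓ w) = 0` on `ℝ^N × (0, T)`. -/
def IsSupersolutionOn (F : E N × ℝ × E N → ℝ) (T : ℝ) (w : E N × ℝ → ℝ) : Prop :=
  ∀ (x : E N) (t : ℝ), 0 < t → t < T → ∀ ψ : E N × ℝ → ℝ, ContDiffAt ℝ 1 ψ (x, t) →
    IsLocalMin (fun q => w q - ψ q) (x, t) →
    0 ≤ deriv (fun s => ψ (x, s)) t + F (x, t, gradient (fun y => ψ (y, t)) x)

/-- `f` is the lift of a function on `𝕋^N × ℝ`. -/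
def IsPeriodic (f : E N × ℝ → ℝ) : Prop :=
  ∀ x y t, proj x = proj y → f (x, t) = f (y, t)

/-- The test function `b(t) + c/2 (|x - y|² + (t - s)²)`. -/
def quadraticTest (b : ℝ → ℝ) (c : ℝ) (y : E N) (s : ℝ) (q : E N × ℝ) : ℝ :=
  b q.2 + c / 2 * (‖q.1 - y‖ ^ 2 + (q.2 - s) ^ 2)

lemma contDiff_quadraticTest {b : ℝ → ℝ} (hb : ContDiff ℝ 1 b) (c : ℝ) (y : E N) (s : ℝ) :
    ContDiff ℝ 1 (quadraticTest b c y s) := by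
  unfold quadraticTest
  have h1 : ContDiff ℝ 1 fun q : E N × ℝ => ‖q.1 - y‖ ^ 2 :=
    (contDiff_fst.sub contDiff_const).norm_sq ℝ
  have h2 : ContDiff ℝ 1 fun q : E N × ℝ => (q.2 - s) ^ 2 :=
    (contDiff_snd.sub contDiff_const).pow 2
  exact (hb.comp contDiff_snd).add (contDiff_const.mul (h1.add h2))

lemma gradient_quadraticTest (b : ℝ → ℝ) (c : ℝ) (y : E N) (s : ℝ) (x : E N) (t : ℝ) :
    gradient (fun z => quadraticTest b c y s (z, t)) x = c • (x - y) := by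
  refine HasGradientAt.gradient ?_
  rw [hasGradientAt_iff_hasFDerivAt]
  have h1 : HasFDerivAt (fun z : E N => ‖z - y‖ ^ 2) (2 • innerSL ℝ (x - y)) x := by
    simpa using ((hasFDerivAt_id x).sub_const y).norm_sq
  refine (((h1.add_const ((t - s) ^ 2)).const_mul (c / 2)).const_add (b t)).congr_fderiv ?_
  ext v
  simp
  ring

lemma deriv_quadraticTest {b : ℝ → ℝ} (hb : ContDiff ℝ 1 b) (c : ℝ) (y : E N) (s : ℝ) (x : E N)
    (t : ℝ) : deriv (fun r => quadraticTest b c y s (x, r)) t = deriv b t + c * (t - s) := by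
  have h1 : HasDerivAt b (deriv b t) t :=
    (hb.differentiable (by norm_num)).differentiableAt.hasDerivAt
  have h2 : HasDerivAt (fun r : ℝ => (r - s) ^ 2) (2 * (t - s)) t := by
    simpa using ((hasDerivAt_id t).sub_const s).fun_pow 2
  have h3 := h1.add ((h2.const_add (‖x - y‖ ^ 2)).const_mul (c / 2))
  refine (h3.congr_deriv ?_).deriv
  ring

/-- Attainment of the doubled maximum, thanks to the common periodicity. -/
lemma exists_doubled_max {f g : E N × ℝ → ℝ} (hf : Continuous f) (hg : Continuous g)
    (hfp : IsPeriodic f) (hgp : IsPeriodic g) {R T : ℝ} (hT : 0 ≤ T)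
    (hR : ∀ x : Torus N, ∃ y : E N, proj y = x ∧ ‖y‖ ≤ R) (c : ℝ) :
    ∃ (x y : E N) (t s : ℝ), ‖x‖ ≤ R ∧ ‖x - y‖ ≤ 1 ∧ t ∈ Set.Icc 0 T ∧ s ∈ Set.Icc 0 T ∧
      ∀ (x' y' : E N) (t' s' : ℝ), ‖x' - y'‖ ≤ 1 → t' ∈ Set.Icc 0 T → s' ∈ Set.Icc 0 T →
        f (x', t') - g (y', s') - c / 2 * (‖x' - y'‖ ^ 2 + (t' - s') ^ 2) ≤
        f (x, t) - g (y, s) - c / 2 * (‖x - y‖ ^ 2 + (t - s) ^ 2) := by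
  -- In the variables `(x, x - y)` a lattice translation moves both points together, so `x` can be
  -- brought into a compact ball while the bounded difference is unchanged.
  set Φ : E N × E N × ℝ × ℝ → ℝ := fun z => f (z.1, z.2.2.1) - g (z.1 - z.2.1, z.2.2.2) -
    c / 2 * (‖z.2.1‖ ^ 2 + (z.2.2.1 - z.2.2.2) ^ 2) with hΦ
  have hΦc : Continuous Φ := by fun_prop
  obtain ⟨y₀, -, hy₀⟩ := hR 0
  obtain ⟨⟨x, e, t, s⟩, ⟨hx, he, ht, hs⟩, hmax⟩ :=
    ((isCompact_closedBall (0 : E N) R).prod ((isCompact_closedBall (0 : E N) 1).prod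
      ((isCompact_Icc (a := (0 : ℝ)) (b := T)).prod
        (isCompact_Icc (a := (0 : ℝ)) (b := T))))).exists_isMaxOn
    ⟨(y₀, 0, 0, 0), by simpa using hy₀, by simp, by simpa using hT, by simpa using hT⟩
    hΦc.continuousOn
  refine ⟨x, x - e, t, s, by simpa using hx, by simpa using he, ht, hs,
    fun x' y' t' s' hxy ht' hs' => ?_⟩
  obtain ⟨z, hz, hzR⟩ := hR (proj x')
  have h1 : Φ (z, x' - y', t', s') ≤ Φ (x, e, t, s) :=
    hmax (⟨by simpa using hzR, by simpa using hxy, ht', hs'⟩ :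
      (z, x' - y', t', s') ∈ Metric.closedBall (0 : E N) R ×ˢ Metric.closedBall (0 : E N) 1 ×ˢ
        Set.Icc (0 : ℝ) T ×ˢ Set.Icc (0 : ℝ) T)
  simp only [hΦ] at h1
  rw [hfp z x' t' hz, hgp (z - (x' - y')) y' s' (by
    rw [proj_sub, hz, ← proj_sub]; congr 1; abel)] at h1
  rwa [sub_sub_cancel]

lemma IsPeriodic.exists_bound {f : E N × ℝ → ℝ} (hfp : IsPeriodic f) (hf : Continuous f)
    (T : ℝ) : ∃ B, 0 ≤ B ∧ ∀ x, ∀ t ∈ Set.Icc 0 T, |f (x, t)| ≤ B := by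
  obtain ⟨R, hR⟩ := exists_bounded_lift N
  obtain ⟨B, hB⟩ := ((isCompact_closedBall (0 : E N) R).prod
    (isCompact_Icc (a := (0 : ℝ)) (b := T))).exists_bound_of_continuousOn hf.continuousOn
  refine ⟨max B 0, le_max_right _ _, fun x t ht => ?_⟩
  obtain ⟨y, hy, hyR⟩ := hR (proj x)
  rw [hfp x y t hy.symm]
  exact (hB (y, t) ⟨by simpa using hyR, ht⟩).trans (le_max_left _ _)

/-- The inequality obtained from the two test functions at an interior doubled maximum. -/
lemma doubled_max_inequality {F G : E N × ℝ × E N → ℝ} {T c : ℝ} {w U : E N × ℝ → ℝ} {b : ℝ → ℝ}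
    (hb : ContDiff ℝ 1 b) (hw : IsSubsolutionOn F T w) (hU : IsSupersolutionOn G T U)
    {x y : E N} {t s : ℝ} (hxy : ‖x - y‖ < 1) (ht : t ∈ Set.Ioo 0 T) (hs : s ∈ Set.Ioo 0 T)
    (hmax : ∀ (x' y' : E N) (t' s' : ℝ), ‖x' - y'‖ ≤ 1 → t' ∈ Set.Icc 0 T → s' ∈ Set.Icc 0 T →
        (w (x', t') - b t') - U (y', s') - c / 2 * (‖x' - y'‖ ^ 2 + (t' - s') ^ 2) ≤
        (w (x, t) - b t) - U (y, s) - c / 2 * (‖x - y‖ ^ 2 + (t - s) ^ 2)) :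
    deriv b t + F (x, t, c • (x - y)) ≤ G (y, s, c • (x - y)) := by
  have hmax1 : IsLocalMax (fun q => w q - quadraticTest b c y s q) (x, t) := by
    have hn : {q : E N × ℝ | ‖q.1 - y‖ < 1} ∈ 𝓝 (x, t) :=
      (isOpen_lt (by fun_prop) continuous_const).mem_nhds hxy
    have hn' : {q : E N × ℝ | q.2 ∈ Set.Ioo 0 T} ∈ 𝓝 (x, t) :=
      (isOpen_Ioo.preimage continuous_snd).mem_nhds ht
    filter_upwards [hn, hn'] with q hq hq'
    have h := hmax q.1 y q.2 s (le_of_lt hq) ⟨hq'.1.le, hq'.2.le⟩ ⟨hs.1.le, hs.2.le⟩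
    simp only [quadraticTest, Prod.mk.eta] at h ⊢
    linarith
  have hmin2 : IsLocalMin (fun q => U q - quadraticTest (fun _ => 0) (-c) x t q) (y, s) := by
    have hn : {q : E N × ℝ | ‖x - q.1‖ < 1} ∈ 𝓝 (y, s) :=
      (isOpen_lt (by fun_prop) continuous_const).mem_nhds hxy
    have hn' : {q : E N × ℝ | q.2 ∈ Set.Ioo 0 T} ∈ 𝓝 (y, s) :=
      (isOpen_Ioo.preimage continuous_snd).mem_nhds hs
    filter_upwards [hn, hn'] with q hq hq'
    have h := hmax x q.1 t q.2 (le_of_lt hq) ⟨ht.1.le, ht.2.le⟩ ⟨hq'.1.le, hq'.2.le⟩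
    have e1 : (q.2 - t) ^ 2 = (t - q.2) ^ 2 := by ring
    have e2 : (s - t) ^ 2 = (t - s) ^ 2 := by ring
    simp only [quadraticTest, norm_sub_rev y x, norm_sub_rev q.1 x, Prod.mk.eta, e1, e2] at h ⊢
    linarith
  have h1 := hw x t ht.1 ht.2 _ (contDiff_quadraticTest hb c y s).contDiffAt hmax1
  have h2 := hU y s hs.1 hs.2 _ (contDiff_quadraticTest contDiff_const (-c) x t).contDiffAt hmin2
  rw [deriv_quadraticTest hb, gradient_quadraticTest] at h1
  rw [deriv_quadraticTest contDiff_const, gradient_quadraticTest] at h2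
  have h3 : -c • (y - x) = c • (x - y) := by rw [neg_smul, ← smul_neg, neg_sub]
  rw [h3, deriv_const] at h2
  linarith

/-- Comparison with strict inequalities; one of the two functions is Lipschitz in space. -/
lemma comparison_strict {F G : E N × ℝ × E N → ℝ} (hF : Continuous F) (hG : Continuous G)
    {T K : ℝ} {w U : E N × ℝ → ℝ} (hwc : Continuous w) (hUc : Continuous U)
    (hwp : IsPeriodic w) (hUp : IsPeriodic U)
    (hw : IsSubsolutionOn F T w) (hU : IsSupersolutionOn G T U)
    (hLip : (∀ x y, ∀ t ∈ Set.Icc 0 T, w (x, t) - w (y, t) ≤ K * ‖x - y‖) ∨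
      ∀ x y, ∀ t ∈ Set.Icc 0 T, U (x, t) - U (y, t) ≤ K * ‖x - y‖)
    {b : ℝ → ℝ} (hb : ContDiff ℝ 1 b)
    (hFG : ∀ x, ∀ t ∈ Set.Ioo 0 T, ∀ p, G (x, t, p) < F (x, t, p) + deriv b t)
    (h0 : ∀ x, w (x, 0) ≤ U (x, 0) + b 0) (hT : ∀ x, w (x, T) ≤ U (x, T) + b T)
    (x : E N) {t : ℝ} (ht : t ∈ Set.Icc 0 T) : w (x, t) ≤ U (x, t) + b t := by
  by_contra! hcon
  have hT0 : 0 ≤ T := ht.1.trans ht.2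
  obtain ⟨R, hR⟩ := exists_bounded_lift N
  have hfc : Continuous fun q : E N × ℝ => w q - b q.2 :=
    hwc.sub (hb.continuous.comp continuous_snd)
  have hfp : IsPeriodic fun q : E N × ℝ => w q - b q.2 := fun x y t h => by
    simp only [hwp x y t h]
  choose X Y τ σ hX hXY hτ hσ hmax using fun n : ℕ =>
    exists_doubled_max hfc hUc hfp hUp hT0 hR ((n : ℝ) + 1)
  -- Compare the maximum with the diagonal pair `(Y, Y)` or `(X, X)`, according to which function is
  -- Lipschitz. The momenta then converge along a subsequence, and continuity of `F` and `G`
  -- suffices in the limit.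
  have hp : ∀ n : ℕ, ‖((n : ℝ) + 1) • (X n - Y n)‖ ≤ 2 * |K| := by
    intro n
    have hn : (0 : ℝ) < n + 1 := by positivity
    have h1 : ((n : ℝ) + 1) / 2 * ‖X n - Y n‖ ^ 2 ≤ K * ‖X n - Y n‖ := by
      rcases hLip with hL | hL
      · have h2 := hmax n (Y n) (Y n) (τ n) (σ n) (by simp) (hτ n) (hσ n)
        have h3 := hL (X n) (Y n) (τ n) (hτ n)
        simp only [sub_self, norm_zero] at h2
        nlinarith
      · have h2 := hmax n (X n) (X n) (τ n) (σ n) (by simp) (hτ n) (hσ n)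
        have h3 := hL (X n) (Y n) (σ n) (hσ n)
        simp only [sub_self, norm_zero] at h2
        nlinarith
    rw [norm_smul, Real.norm_of_nonneg hn.le]
    rcases (norm_nonneg (X n - Y n)).eq_or_lt with h | h
    · rw [← h, mul_zero]; positivity
    · have h2 : ((n : ℝ) + 1) / 2 * ‖X n - Y n‖ ≤ K := by
        refine le_of_mul_le_mul_right ?_ h
        nlinarith
      linarith [le_abs_self K]
  have hY : ∀ n, ‖Y n‖ ≤ R + 1 := fun n => by
    have := norm_sub_norm_le (Y n) (X n)
    rw [norm_sub_rev] at this
    linarith [hX n, hXY n]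
  obtain ⟨⟨x₀, y₀, t₀, s₀, p₀⟩, ⟨-, -, ht₀, -, -⟩, k, hk, hlim⟩ :=
    ((isCompact_closedBall (0 : E N) R).prod ((isCompact_closedBall (0 : E N) (R + 1)).prod
      ((isCompact_Icc (a := (0 : ℝ)) (b := T)).prod ((isCompact_Icc (a := (0 : ℝ)) (b := T)).prod
        (isCompact_closedBall (0 : E N) (2 * |K|)))))).tendsto_subseq
    (x := fun n : ℕ => (X n, Y n, τ n, σ n, ((n : ℝ) + 1) • (X n - Y n)))
    (fun n => ⟨by simpa using hX n, by simpa using hY n, hτ n, hσ n, by simpa using hp n⟩)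
  have hlX : Tendsto (X ∘ k) atTop (𝓝 x₀) := (continuous_fst.tendsto _).comp hlim
  have hlim1 := (continuous_snd.tendsto _).comp hlim
  have hlY : Tendsto (Y ∘ k) atTop (𝓝 y₀) := (continuous_fst.tendsto _).comp hlim1
  have hlim2 := (continuous_snd.tendsto _).comp hlim1
  have hlτ : Tendsto (τ ∘ k) atTop (𝓝 t₀) := (continuous_fst.tendsto _).comp hlim2
  have hlim3 := (continuous_snd.tendsto _).comp hlim2
  have hlσ : Tendsto (σ ∘ k) atTop (𝓝 s₀) := (continuous_fst.tendsto _).comp hlim3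
  have hlp : Tendsto (fun n => ((k n : ℝ) + 1) • (X (k n) - Y (k n))) atTop (𝓝 p₀) :=
    (continuous_snd.tendsto _).comp hlim3
  obtain ⟨A, hA0, hA⟩ := hfp.exists_bound hfc T
  obtain ⟨B, hB0, hB⟩ := hUp.exists_bound hUc T
  -- The diagonal point `(x, x, t, t)` has no penalty, so the assumed positive excess bounds all
  -- doubled maxima from below and survives in the limit.
  have hlow : ∀ n, w (x, t) - b t - U (x, t) ≤ w (X n, τ n) - b (τ n) - U (Y n, σ n) -
      ((n : ℝ) + 1) / 2 * (‖X n - Y n‖ ^ 2 + (τ n - σ n) ^ 2) := fun n => by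
    have := hmax n x x t t (by simp) ht ht
    simpa using this
  have hsq : ∀ n : ℕ, ‖X n - Y n‖ ^ 2 + (τ n - σ n) ^ 2 ≤ 2 * (A + B) * (1 / ((n : ℝ) + 1)) := by
    intro n
    have h1 := hlow n
    have h2 := abs_le.1 (hA (X n) (τ n) (hτ n))
    have h3 := abs_le.1 (hB (Y n) (σ n) (hσ n))
    have hn : (0 : ℝ) < n + 1 := by positivity
    rw [mul_one_div, le_div_iff₀ hn]
    simp only at h2
    nlinarith
  have hzero : ‖x₀ - y₀‖ ^ 2 + (t₀ - s₀) ^ 2 ≤ 0 := by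
    have h1 : Tendsto (fun n => ‖(X ∘ k) n - (Y ∘ k) n‖ ^ 2 + ((τ ∘ k) n - (σ ∘ k) n) ^ 2) atTop
        (𝓝 (‖x₀ - y₀‖ ^ 2 + (t₀ - s₀) ^ 2)) :=
      ((hlX.sub hlY).norm.pow 2).add ((hlτ.sub hlσ).pow 2)
    have h2 : Tendsto (fun n : ℕ => 2 * (A + B) * (1 / ((k n : ℝ) + 1))) atTop (𝓝 0) := by
      have := (tendsto_one_div_add_atTop_nhds_zero_nat (𝕜 := ℝ)).comp hk.tendsto_atTop
      simpa using this.const_mul (2 * (A + B))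
    exact le_of_tendsto_of_tendsto' h1 h2 fun n => hsq (k n)
  have hxy₀ : x₀ = y₀ := by
    have : ‖x₀ - y₀‖ ^ 2 = 0 := le_antisymm (by nlinarith [sq_nonneg (t₀ - s₀)]) (sq_nonneg _)
    simpa [sub_eq_zero] using this
  have hts₀ : t₀ = s₀ := by
    have : (t₀ - s₀) ^ 2 = 0 := le_antisymm (by nlinarith [sq_nonneg ‖x₀ - y₀‖]) (sq_nonneg _)
    simpa [sub_eq_zero] using this
  subst hxy₀ hts₀
  have hpos : 0 < w (x₀, t₀) - b t₀ - U (x₀, t₀) := by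
    have h1 : Tendsto (fun n => w ((X ∘ k) n, (τ ∘ k) n) - b ((τ ∘ k) n) -
        U ((Y ∘ k) n, (σ ∘ k) n)) atTop (𝓝 (w (x₀, t₀) - b t₀ - U (x₀, t₀))) :=
      (((hwc.tendsto _).comp (hlX.prodMk_nhds hlτ)).sub ((hb.continuous.tendsto _).comp hlτ)).sub
        ((hUc.tendsto _).comp (hlY.prodMk_nhds hlσ))
    have h2 : w (x, t) - b t - U (x, t) ≤ w (x₀, t₀) - b t₀ - U (x₀, t₀) :=
      ge_of_tendsto' h1 fun n => by
        have h3 := hlow (k n)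
        have h4 : 0 ≤ ((k n : ℝ) + 1) / 2 *
          (‖X (k n) - Y (k n)‖ ^ 2 + (τ (k n) - σ (k n)) ^ 2) := by positivity
        simp only [Function.comp_apply]
        linarith
    linarith
  have htI : t₀ ∈ Set.Ioo 0 T := by
    refine ⟨lt_of_le_of_ne ht₀.1 fun h => ?_, lt_of_le_of_ne ht₀.2 fun h => ?_⟩
    · rw [← h] at hpos; linarith [h0 x₀]
    · rw [h] at hpos; linarith [hT x₀]
  have hev : ∀ᶠ n in atTop, deriv b (τ (k n)) +
      F (X (k n), τ (k n), ((k n : ℝ) + 1) • (X (k n) - Y (k n))) ≤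
      G (Y (k n), σ (k n), ((k n : ℝ) + 1) • (X (k n) - Y (k n))) := by
    have h1 : ∀ᶠ n in atTop, ‖(X ∘ k) n - (Y ∘ k) n‖ < 1 :=
      (hlX.sub hlY).norm.eventually (gt_mem_nhds (by simp))
    filter_upwards [h1, hlτ.eventually (Ioo_mem_nhds htI.1 htI.2),
      hlσ.eventually (Ioo_mem_nhds htI.1 htI.2)] with n hn1 hn2 hn3
    exact doubled_max_inequality hb hw hU hn1 hn2 hn3 (hmax (k n))
  have hbc : Continuous (deriv b) := hb.continuous_deriv le_rfl
  have hle : deriv b t₀ + F (x₀, t₀, p₀) ≤ G (x₀, t₀, p₀) :=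
    le_of_tendsto_of_tendsto
      (((hbc.tendsto _).comp hlτ).add
        ((hF.tendsto _).comp (hlX.prodMk_nhds (hlτ.prodMk_nhds hlp))))
      ((hG.tendsto _).comp (hlY.prodMk_nhds (hlσ.prodMk_nhds hlp))) hev
  linarith [hFG x₀ t₀ htI p₀]

/-- Comparison up to a time-dependent error `b`. -/
lemma comparison {F G : E N × ℝ × E N → ℝ} (hF : Continuous F) (hG : Continuous G)
    {T K : ℝ} {w U : E N × ℝ → ℝ} (hwc : Continuous w) (hUc : Continuous U)
    (hwp : IsPeriodic w) (hUp : IsPeriodic U)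
    (hw : IsSubsolutionOn F T w) (hU : IsSupersolutionOn G T U)
    (hLip : (∀ x y, ∀ t ∈ Set.Icc 0 T, w (x, t) - w (y, t) ≤ K * ‖x - y‖) ∨
      ∀ x y, ∀ t ∈ Set.Icc 0 T, U (x, t) - U (y, t) ≤ K * ‖x - y‖)
    {b : ℝ → ℝ} (hb : ContDiff ℝ 1 b)
    (hFG : ∀ x, ∀ t ∈ Set.Ioo 0 T, ∀ p, G (x, t, p) ≤ F (x, t, p) + deriv b t)
    (h0 : ∀ x, w (x, 0) ≤ U (x, 0) + b 0)
    (x : E N) {t : ℝ} (ht : t ∈ Set.Icc 0 T) : w (x, t) ≤ U (x, t) + b t := by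
  rcases ht.1.eq_or_lt with rfl | ht0
  · exact h0 x
  have hlt : ∀ t₁ ∈ Set.Ico 0 T, w (x, t₁) ≤ U (x, t₁) + b t₁ := by
    intro t₁ ht₁
    by_contra! hcon
    set σ := (w (x, t₁) - (U (x, t₁) + b t₁)) / 2 with hσ
    have hσ0 : 0 < σ := by rw [hσ]; linarith
    have hT1 : 0 < T - t₁ := by linarith [ht₁.2]
    have hT0 : T ∈ Set.Icc 0 T := ⟨by linarith [ht₁.1], le_rfl⟩
    obtain ⟨A, hA0, hA⟩ := hwp.exists_bound hwc T
    obtain ⟨B, hB0, hB⟩ := hUp.exists_bound hUc T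
    -- The penalty `σ e^{Λ(s - t₁)}` has positive derivative, making the inequality strict. It
    -- equals half the excess at `t₁`, and this `Λ` makes it large enough at `T` for the terminal
    -- condition to hold automatically.
    set Λ := (A + B + |b T| + 1) / (σ * (T - t₁)) with hΛ
    have hΛ0 : 0 < Λ := by positivity
    have hb' : ContDiff ℝ 1 fun s => b s + σ * Real.exp (Λ * (s - t₁)) :=
      hb.add (contDiff_const.mul
        (Real.contDiff_exp.comp (contDiff_const.mul (contDiff_id.sub contDiff_const))))
    have hder : ∀ s, deriv (fun s => b s + σ * Real.exp (Λ * (s - t₁))) s =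
        deriv b s + σ * (Real.exp (Λ * (s - t₁)) * Λ) := by
      intro s
      have h1 : HasDerivAt b (deriv b s) s :=
        (hb.differentiable (by norm_num)).differentiableAt.hasDerivAt
      have h2 : HasDerivAt (fun s => Λ * (s - t₁)) Λ s := by
        simpa using ((hasDerivAt_id s).sub_const t₁).const_mul Λ
      exact (h1.add (h2.exp.const_mul σ)).deriv
    have key := comparison_strict hF hG hwc hUc hwp hUp hw hU hLip hb'
      (fun y s hs p => by
        have h1 := hFG y s hs p
        have h2 : 0 < σ * (Real.exp (Λ * (s - t₁)) * Λ) := by positivity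
        rw [hder]; linarith)
      (fun y => by
        have h1 : 0 < σ * Real.exp (Λ * (0 - t₁)) := by positivity
        linarith [h0 y])
      (fun y => by
        have h1 := abs_le.1 (hA y T hT0)
        have h2 := abs_le.1 (hB y T hT0)
        have h3 := neg_abs_le (b T)
        have h4 : Λ * (T - t₁) ≤ Real.exp (Λ * (T - t₁)) := by
          linarith [Real.add_one_le_exp (Λ * (T - t₁))]
        have h5 : σ * (Λ * (T - t₁)) = A + B + |b T| + 1 := by
          rw [hΛ]; field_simp
        have h6 : σ * (Λ * (T - t₁)) ≤ σ * Real.exp (Λ * (T - t₁)) := by gcongr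
        linarith)
      x (t := t₁) ⟨ht₁.1, ht₁.2.le⟩
    simp only [sub_self, mul_zero, Real.exp_zero, mul_one] at key
    linarith
  have hcl : t ∈ closure (Set.Ico 0 T) := by
    rw [closure_Ico (by linarith [ht.2])]
    exact ht
  have hc1 : Continuous fun s => w (x, s) := by fun_prop
  have hc2 : Continuous fun s => U (x, s) + b s := by
    have := hb.continuous
    fun_prop
  exact le_on_closure (f := fun s => w (x, s)) (g := fun s => U (x, s) + b s) hlt
    hc1.continuousOn hc2.continuousOn hcl

end Comparison

/-! ### Uniqueness of viscosity solutions -/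

section Uniqueness

variable {N m : ℕ} {H : Fin m → Torus N → E N → (Fin m → ℝ) → ℝ} {φ φ' : C(Torus N, Fin m → ℝ)}
  {u v : C(Torus N × ℝ≥0, Fin m → ℝ)}

/-- The lift of the `i`-th component of `u` to `ℝ^N × ℝ`. -/
def liftComponent (u : C(Torus N × ℝ≥0, Fin m → ℝ)) (i : Fin m) (q : E N × ℝ) : ℝ :=
  u (proj q.1, q.2.toNNReal) i

/-- The Hamiltonian `H(x, p, u(x, t))` with the coupling frozen, lifted to `ℝ^N`. -/
def frozenHamiltonian (H : Torus N → E N → (Fin m → ℝ) → ℝ)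
    (u : C(Torus N × ℝ≥0, Fin m → ℝ)) (z : E N × ℝ × E N) : ℝ :=
  H (proj z.1) z.2.2 (u (proj z.1, z.2.1.toNNReal))

lemma continuous_liftComponent (u : C(Torus N × ℝ≥0, Fin m → ℝ)) (i : Fin m) :
    Continuous (liftComponent u i) :=
  (continuous_apply i).comp (continuous_lift u)

lemma isPeriodic_liftComponent (u : C(Torus N × ℝ≥0, Fin m → ℝ)) (i : Fin m) :
    IsPeriodic (liftComponent u i) := fun x y t h => by
  simp only [liftComponent, h]

lemma IsAdmissible.continuous_frozenHamiltonian {H : Torus N → E N → (Fin m → ℝ) → ℝ}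
    (hH : IsAdmissible H) (u : C(Torus N × ℝ≥0, Fin m → ℝ)) :
    Continuous (frozenHamiltonian H u) := by
  have h1 : Continuous fun z : E N × ℝ × E N => u (proj z.1, z.2.1.toNNReal) :=
    (continuous_lift u).comp (f := fun z : E N × ℝ × E N => (z.1, z.2.1)) (by fun_prop)
  have h2 : Continuous fun z : E N × ℝ × E N => proj z.1 := (continuous_proj N).comp continuous_fst
  exact hH.continuous.comp
    (f := fun z : E N × ℝ × E N => (proj z.1, z.2.2, u (proj z.1, z.2.1.toNNReal)))
    (h2.prodMk ((by fun_prop : Continuous fun z : E N × ℝ × E N => z.2.2).prodMk h1))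

lemma IsViscositySubsolution.isSubsolutionOn (hu : IsViscositySubsolution H φ u) (i : Fin m)
    (T : ℝ) : IsSubsolutionOn (frozenHamiltonian (H i) u) T (liftComponent u i) :=
  fun x t ht _ ψ hψ hmax => (hu i).2 x t ht ψ hψ hmax

lemma IsViscositySupersolution.isSupersolutionOn (hu : IsViscositySupersolution H φ u)
    (i : Fin m) (T : ℝ) : IsSupersolutionOn (frozenHamiltonian (H i) u) T (liftComponent u i) :=
  fun x t ht _ ψ hψ hmin => (hu i).2 x t ht ψ hψ hmin

/-- The scalar comparison for one component, with the coupling errors measured by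
`d e^{2 Θ t}`. -/
lemma component_le {Θ κ d T K : ℝ} (hH : ∀ i, IsAdmissible (H i))
    (hΘ : ∀ i, LipschitzInU (H i) Θ) (hΘ0 : 0 < Θ) (hd : 0 ≤ d)
    (hu : IsViscositySubsolution H φ u) (hv : IsViscositySupersolution H φ' v)
    (hφ : ∀ x i, φ x i ≤ φ' x i + κ)
    (hduv : ∀ x, ∀ t ∈ Set.Icc 0 T,
      ‖u (x, t.toNNReal) - v (x, t.toNNReal)‖ ≤ d * Real.exp (2 * Θ * t))
    (hLip : (∀ i (x y : E N), ∀ t ∈ Set.Icc 0 T,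
        liftComponent u i (x, t) - liftComponent u i (y, t) ≤ K * ‖x - y‖) ∨
      ∀ i (x y : E N), ∀ t ∈ Set.Icc 0 T,
        liftComponent v i (x, t) - liftComponent v i (y, t) ≤ K * ‖x - y‖)
    (i : Fin m) (x : E N) {t : ℝ} (ht : t ∈ Set.Icc 0 T) :
    u (proj x, t.toNNReal) i - v (proj x, t.toNNReal) i ≤ κ + d / 2 * Real.exp (2 * Θ * t) := by
  -- The derivative of the corrector is exactly the bound `Θ * (d * e^{2Θs})` for the change of `H`
  -- between the two couplings.
  have hder : ∀ s, HasDerivAt (fun s => κ + d / 2 * Real.exp (2 * Θ * s))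
      (Θ * (d * Real.exp (2 * Θ * s))) s := by
    intro s
    have h1 : HasDerivAt (fun s => 2 * Θ * s) (2 * Θ) s := by
      simpa using (hasDerivAt_id s).const_mul (2 * Θ)
    refine ((h1.exp.const_mul (d / 2)).const_add κ).congr_deriv ?_
    ring
  have key := comparison ((hH i).continuous_frozenHamiltonian u)
    ((hH i).continuous_frozenHamiltonian v) (continuous_liftComponent u i)
    (continuous_liftComponent v i) (isPeriodic_liftComponent u i) (isPeriodic_liftComponent v i)
    (hu.isSubsolutionOn i T) (hv.isSupersolutionOn i T)
    (hLip.imp (fun h => h i) fun h => h i)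
    (b := fun s => κ + d / 2 * Real.exp (2 * Θ * s))
    (contDiff_const.add (contDiff_const.mul
      (Real.contDiff_exp.comp (contDiff_const.mul contDiff_id))))
    (fun y s hs p => by
      rw [(hder s).deriv]
      have h1 := abs_le.1 (hΘ i (proj y) p (u (proj y, s.toNNReal)) (v (proj y, s.toNNReal)))
      have h2 : Θ * ‖u (proj y, s.toNNReal) - v (proj y, s.toNNReal)‖ ≤
          Θ * (d * Real.exp (2 * Θ * s)) := by
        gcongr; exact hduv _ s ⟨hs.1.le, hs.2.le⟩
      simp only [frozenHamiltonian]
      linarith [h1.1])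
    (fun y => by
      have h1 := (hu i).1 (proj y)
      have h2 := (hv i).1 (proj y)
      have h3 := hφ (proj y) i
      simp only [liftComponent, Real.toNNReal_zero, mul_zero, Real.exp_zero]
      linarith)
    x ht
  simp only [liftComponent] at key
  linarith

/-- Stability of a viscosity solution with respect to the datum, when the second solution is
Lipschitz in space. -/
lemma norm_sub_le_of_viscosity {Θ κ T K : ℝ} (hH : ∀ i, IsAdmissible (H i))
    (hΘ : ∀ i, LipschitzInU (H i) Θ) (hΘ0 : 0 < Θ) (hκ : 0 ≤ κ)
    (hu : IsViscositySolution H φ u) (hv : IsViscositySolution H φ' v)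
    (hφ : ∀ x i, |φ' x i - φ x i| ≤ κ)
    (hLip : ∀ i (x y : E N), ∀ t ∈ Set.Icc 0 T,
        liftComponent v i (x, t) - liftComponent v i (y, t) ≤ K * ‖x - y‖)
    (x : Torus N) {t : ℝ} (ht : t ∈ Set.Icc 0 T) :
    ‖u (x, t.toNNReal) - v (x, t.toNNReal)‖ ≤ 2 * κ * Real.exp (2 * Θ * t) := by
  have hcont : Continuous fun q : Torus N × ℝ => Real.exp (-(2 * Θ * q.2)) *
      ‖u (q.1, q.2.toNNReal) - v (q.1, q.2.toNNReal)‖ := by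
    have h1 : ∀ u : C(Torus N × ℝ≥0, Fin m → ℝ),
        Continuous fun q : Torus N × ℝ => u (q.1, q.2.toNNReal) := fun u =>
      u.continuous.comp (continuous_fst.prodMk (continuous_real_toNNReal.comp continuous_snd))
    exact (by fun_prop : Continuous fun q : Torus N × ℝ => Real.exp (-(2 * Θ * q.2))).mul
      ((h1 u).sub (h1 v)).norm
  obtain ⟨⟨x₀, t₀⟩, ⟨-, ht₀⟩, hmax⟩ :=
    ((isCompact_univ (X := Torus N)).prod (isCompact_Icc (a := 0) (b := T))).exists_isMaxOn
    ⟨(x, t), trivial, ht⟩ hcont.continuousOn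
  set d : ℝ := Real.exp (-(2 * Θ * t₀)) * ‖u (x₀, t₀.toNNReal) - v (x₀, t₀.toNNReal)‖ with hd
  have hd0 : 0 ≤ d := by positivity
  have hbd : ∀ y, ∀ s ∈ Set.Icc 0 T,
      ‖u (y, s.toNNReal) - v (y, s.toNNReal)‖ ≤ d * Real.exp (2 * Θ * s) := by
    intro y s hs
    have h1 : Real.exp (-(2 * Θ * s)) * ‖u (y, s.toNNReal) - v (y, s.toNNReal)‖ ≤ d :=
      hmax (⟨trivial, hs⟩ : (y, s) ∈ Set.univ ×ˢ Set.Icc 0 T)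
    rwa [Real.exp_neg, inv_mul_le_iff₀ (Real.exp_pos _), mul_comm] at h1
  have hest : ‖u (x₀, t₀.toNNReal) - v (x₀, t₀.toNNReal)‖ ≤
      κ + d / 2 * Real.exp (2 * Θ * t₀) := by
    obtain ⟨y, rfl⟩ := proj_surjective N x₀
    refine (pi_norm_le_iff_of_nonneg (by positivity)).2 fun i => ?_
    -- Comparison is used in both directions, with the Lipschitz function `v` first as supersolution
    -- and then as subsolution; hence the alternative in the Lipschitz hypothesis.
    have h1 := component_le (κ := κ) hH hΘ hΘ0 hd0 hu.1 hv.2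
      (fun x i => by linarith [(abs_le.1 (hφ x i)).1]) hbd (Or.inr hLip) i y ht₀
    have h2 := component_le (κ := κ) hH hΘ hΘ0 hd0 hv.1 hu.2
      (fun x i => by linarith [(abs_le.1 (hφ x i)).2])
      (fun x t ht => by rw [norm_sub_rev]; exact hbd x t ht) (Or.inl hLip) i y ht₀
    rw [Pi.sub_apply, Real.norm_eq_abs, abs_le]
    constructor <;> linarith
  have hd2 : d ≤ 2 * κ := by
    have h2 : Real.exp (-(2 * Θ * t₀)) ≤ 1 :=
      Real.exp_le_one_iff.2 (by have := ht₀.1; simp only [Left.neg_nonpos_iff]; positivity)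
    have h3 : d ≤ Real.exp (-(2 * Θ * t₀)) * (κ + d / 2 * Real.exp (2 * Θ * t₀)) := by
      rw [hd]; gcongr
    have h4 : Real.exp (-(2 * Θ * t₀)) * (d / 2 * Real.exp (2 * Θ * t₀)) = d / 2 := by
      rw [Real.exp_neg]; field_simp
    have h5 : Real.exp (-(2 * Θ * t₀)) * κ ≤ 1 * κ := by gcongr
    linarith
  refine (hbd x t ht).trans ?_
  gcongr

/-- Neither solution need be Lipschitz, so they are not compared directly: both lie within `ε / 2`,
at the given time, of the variational solution for a nearby Lipschitz datum. -/
theorem IsViscositySolution.unique (hH : ∀ i, IsAdmissible (H i))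
    (hu : IsViscositySolution H φ u) (hv : IsViscositySolution H φ v) : u = v := by
  obtain ⟨Θ, hΘ0, hΘ⟩ := exists_common_lipschitz hH
  ext1 ⟨x, t⟩
  rw [← sub_eq_zero, ← norm_le_zero_iff]
  refine le_of_forall_pos_le_add fun ε hε => ?_
  -- Chosen so that the stability bound `2 * κ * e^{2Θt}` equals `ε / 2`.
  set κ : ℝ := ε / (4 * Real.exp (2 * Θ * t)) with hκ
  have hκ0 : 0 < κ := by positivity
  obtain ⟨φ', K, hK, hφ, hφL⟩ := exists_lipschitz_datum φ hκ0
  obtain ⟨w, hw⟩ := exists_isVariationalSolution hH φ'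
  obtain ⟨M, -, hM⟩ := hw.exists_lipschitz_space hH hK hφL t
  have key : ∀ u, IsViscositySolution H φ u → ‖u (x, t) - w (x, t)‖ ≤ ε / 2 := by
    intro u hu
    have h1 := norm_sub_le_of_viscosity hH hΘ hΘ0 hκ0.le hu (hw.isViscositySolution hH) hφ
      (fun i x y s hs => hM i y x s hs.1 hs.2) x (t := t) ⟨t.2, le_rfl⟩
    rw [Real.toNNReal_coe] at h1
    refine h1.trans (le_of_eq ?_)
    rw [hκ]
    field_simp
    norm_num
  calc ‖u (x, t) - v (x, t)‖ = ‖(u (x, t) - w (x, t)) - (v (x, t) - w (x, t))‖ := by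
        rw [sub_sub_sub_cancel_right]
    _ ≤ ‖u (x, t) - w (x, t)‖ + ‖v (x, t) - w (x, t)‖ := norm_sub_le _ _
    _ ≤ 0 + ε := by linarith [key u hu, key v hv]

end Uniqueness

end WeaklyCoupledHJ

end

theorem theorem1p1 {N m : ℕ} (hN : 0 < N) (hm : 0 < m)
    (H : Fin m → WeaklyCoupledHJ.Torus N → WeaklyCoupledHJ.E N → (Fin m → ℝ) → ℝ)
    (hH : ∀ i, WeaklyCoupledHJ.IsAdmissible (H i))
    (φ : C(WeaklyCoupledHJ.Torus N, Fin m → ℝ)) :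
    (∃! u : C(WeaklyCoupledHJ.Torus N × ℝ≥0, Fin m → ℝ),
      WeaklyCoupledHJ.IsViscositySolution H φ u) ∧
    (∀ u : C(WeaklyCoupledHJ.Torus N × ℝ≥0, Fin m → ℝ),
      WeaklyCoupledHJ.IsViscositySolution H φ u ↔
        WeaklyCoupledHJ.IsVariationalSolution H φ u) := by
  obtain ⟨v, hv⟩ := WeaklyCoupledHJ.exists_isVariationalSolution hH φ
  have hv' := hv.isViscositySolution hH
  refine ⟨⟨v, hv', fun u hu => hu.unique hH hv'⟩, fun u => ⟨fun hu => ?_, fun hu =>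
    hu.isViscositySolution hH⟩⟩
  rw [hu.unique hH hv']
  exact hv
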